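/- For $k\ge 1$ let $p_k=2^k$ if $k$ is even, $p_k=2^k+1$ if $k$ is odd, $d_k=2^{k^2}$, $\alpha_1=\tfrac12$ and $\alpha_k=\dfrac{1}{p_k\sqrt{k\log_2 k}}$ for $k\ge 2$. Let $(\Omega,\mathcal F,m)$ be a standard Borel probability space and $T:\Omega\to\Omega$ an invertible, ergodic, aperiodic, $m$-preserving transformation. Call a family of measurable functions $\bar f^{(i)}_k:\Omega\to\{-1,0,1\}$ ($k\ge1$, $i\in\{1,2\}$) a *building family* if, for every $k\ge 1$: (a) $m(\bar f^{(i)}_k=1)=m(\bar f^{(i)}_k=-1)=\alpha_k^2/2$ for $i=1,2$; (b) the functions $\bar f^{(i)}_k\circ T^j$, $0\le j\le 2d_k+p_k$, $i\in\{1,2\}$, are i.i.d.; (c) the functions in (b) are jointly independent of the family $\{\bar f^{(i)}_l\circ T^j:\ 1\le l<k,\ i\in\{1,2\},\ 0\le j\le 2d_k+p_k\}$. For a building family put $$f^{(i)}_k=\sum_{j=0}^{p_k-1}\left(\bar f^{(i)}_k\circ T^j-\bar f^{(i)}_k\circ T^{d_k+j}\right),\qquad f=\left(\sum_{k\ge1}f^{(1)}_k,\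 \sum_{k\ge1}f^{(2)}_k\right):\Omega\to\mathbb Z^2,$$ and let $S_n(f)=\sum_{k=0}^{n-1}f\circ T^k$ for $n\ge 0$ and $S_n(f)=-\sum_{k=n}^{-1}f\circ T^k$ for $n<0$. Then a building family exists. Moreover, for every building family, $f$ is well defined (for $m$-a.e. $x$ only finitely many $f^{(i)}_k(x)$ are nonzero), and for every integer $N\ge0$ each of the following three events has positive $m$-measure: 1. $(0,0)<S_1(f)<S_2(f)<\dots<S_{2N}(f)$ in the lexicographic order of $\mathbb Z^2$; 2. $\left|\{S_{j+N}(f)-S_N(f):\ -N\le j\le N\}\right|=2N+1$; 3. $\left|\{S_j(f):\ -N\le j\le N\}\right|=2N+1$. -/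

import Mathlib

open MeasureTheory ProbabilityTheory

namespace LCLT

/-- `p k = 2^k` for even `k` and `p k = 2^k + 1` for odd `k`. -/
def p (k : ℕ) : ℕ := if Even k then 2 ^ k else 2 ^ k + 1

/-- `d k = 2^(k^2)`. -/
def d (k : ℕ) : ℕ := 2 ^ (k ^ 2)

/-- `α 1 = 1/2` and `α k = 1 / (p k * √(k * log k))` for `k ≥ 2`.  The logarithm is to base `2`,
the base for which the limiting variance of the construction is `2 (ln 2)^2`.
The value at `k = 0` is never used. -/
noncomputable def α (k : ℕ) : ℝ :=
  if k = 1 then 1 / 2 else 1 / ((p k : ℝ) * Real.sqrt ((k : ℝ) * Real.logb 2 k))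

variable {Ω : Type*} [MeasurableSpace Ω]

/-- The transformation is aperiodic: almost no point is periodic. -/
def Aperiodic (m : Measure Ω) (T : Ω ≃ᵐ Ω) : Prop :=
  ∀ᵐ x ∂m, ∀ n : ℕ, 1 ≤ n → T^[n] x ≠ x

/-- The building blocks of the construction: a family of functions `fbar k i`, `k ≥ 1`,
`i ∈ {1, 2}` (here `i : Fin 2`), with values in `{-1, 0, 1}`. Index `k = 0` is never used. -/
structure IsBuildingFamily (m : Measure Ω) (T : Ω ≃ᵐ Ω) (fbar : ℕ → Fin 2 → Ω → ℤ) : Prop where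
  measurable : ∀ k, 1 ≤ k → ∀ i, Measurable (fbar k i)
  values : ∀ k, 1 ≤ k → ∀ i x, fbar k i x = -1 ∨ fbar k i x = 0 ∨ fbar k i x = 1
  /-- The prescribed one-dimensional distribution. -/
  prob_one : ∀ k, 1 ≤ k → ∀ i, m {x | fbar k i x = 1} = ENNReal.ofReal (α k ^ 2 / 2)
  prob_neg_one : ∀ k, 1 ≤ k → ∀ i, m {x | fbar k i x = -1} = ENNReal.ofReal (α k ^ 2 / 2)
  /-- For each `k`, the functions `fbar k i ∘ T^j`, `0 ≤ j ≤ 2 d_k + p_k`, are i.i.d. -/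
  indep_time : ∀ k, 1 ≤ k →
    iIndepFun (fun (q : Fin 2 × Fin (2 * d k + p k + 1)) (x : Ω) => fbar k q.1 (T^[q.2] x)) m
  ident_time : ∀ k, 1 ≤ k → ∀ q r : Fin 2 × Fin (2 * d k + p k + 1),
    IdentDistrib (fun x => fbar k q.1 (T^[q.2] x)) (fun x => fbar k r.1 (T^[r.2] x)) m m
  /-- For each `k`, those functions are, jointly, independent of all the functions
  `fbar l i ∘ T^j`, `1 ≤ l < k`, `0 ≤ j ≤ 2 d_k + p_k`. -/
  indep_level : ∀ k, 1 ≤ k →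
    IndepFun
      (fun (x : Ω) (q : Fin 2 × Fin (2 * d k + p k + 1)) => fbar k q.1 (T^[q.2] x))
      (fun (x : Ω) (q : Finset.Ico 1 k × Fin 2 × Fin (2 * d k + p k + 1)) =>
        fbar q.1 q.2.1 (T^[q.2.2] x)) m

/-- `f_k^(i) = ∑_{j < p_k} (fbar_k^(i) ∘ T^j - fbar_k^(i) ∘ T^(d_k + j))`. -/
def level (T : Ω ≃ᵐ Ω) (fbar : ℕ → Fin 2 → Ω → ℤ) (k : ℕ) (i : Fin 2) (x : Ω) : ℤ :=
  ∑ j ∈ Finset.range (p k), (fbar k i (T^[j] x) - fbar k i (T^[d k + j] x))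

/-- The coordinate `f^(i) = ∑_{k ≥ 1} f_k^(i)`. A sum of integers converges if and only if
it has finitely many nonzero terms; the value is `0` where it does not converge. -/
noncomputable def coord (T : Ω ≃ᵐ Ω) (fbar : ℕ → Fin 2 → Ω → ℤ) (i : Fin 2) (x : Ω) : ℤ :=
  ∑' k : ℕ, level T fbar (k + 1) i x

/-- The function `f = (f^(1), f^(2)) : Ω → ℤ²`. -/
noncomputable def lcltFun (T : Ω ≃ᵐ Ω) (fbar : ℕ → Fin 2 → Ω → ℤ) (x : Ω) : ℤ × ℤ :=
  (coord T fbar 0 x, coord T fbar 1 x)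

/-- The cocycle `S_n(f)`, `n ∈ ℤ`: `∑_{k=0}^{n-1} f ∘ T^k` for `n ≥ 0` and
`-∑_{k=n}^{-1} f ∘ T^k` for `n < 0`. -/
def S (T : Ω ≃ᵐ Ω) (f : Ω → ℤ × ℤ) : ℤ → Ω → ℤ × ℤ
  | Int.ofNat n, x => ∑ k ∈ Finset.range n, f (T^[k] x)
  | Int.negSucc n, x => -∑ k ∈ Finset.range (n + 1), f (T.symm^[k + 1] x)

end LCLT

/-!
Existence. A building family is constructed level by level. At level `k` one needs a function `g`
whose first `L = 2 d_k + p_k + 1` translates are exactly i.i.d. with a given law and independent of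
a given finite-valued function `G`, although `T` may have entropy zero (`exists_iid_window`). The
idea is to cut orbits into pieces. Aperiodicity gives marker sets with bounded gaps
(`exists_marker`), and the absence of atoms gives random choices attached to the points of a marker
set that are independent of any finite amount of information (`exists_indep_of_finite_family`). The
choices at different points of one orbit may depend on each other, so a window of length `L` must
never see two of them. Therefore each piece begins with a constant word of length `L`. The deficit
in randomness caused by these words is compensated as follows. The starting points `B` of the pieces
are a random selection, with probability `1 / r`, from a larger marker set `D`
(`exists_nested_markers`). At the points of `D` that are not selected, one writes a word of law `κ`,
where `(1 / r) δ + (1 - 1 / r) κ` is the i.i.d. law and `δ` is the point mass at the constant word.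
Such a `κ` exists once `1 / r` is at most the i.i.d. probability of the constant word. On average
over the selection, the words at the points of `D` are then exactly i.i.d., also given `G`.

Positivity. All three events contain, up to a translation by `T ^ N`, the event that the first
coordinate of `f` is positive at `2 N` consecutive points of the orbit, since then the first
coordinate of `S_n(f)` is strictly increasing for `0 ≤ n ≤ 2 N`. That event has positive probability
(`IsBuildingFamily.exists_one_le_coord`). The finitely many small levels contribute at least `-R`.
One high level can be prescribed to contribute more than `R`, and all other levels can be required
to vanish on the relevant times, at a cost that is small in total. The levels are independent on
these times, so the infinite intersection still has positive measure.
-/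

open MeasureTheory ProbabilityTheory

namespace LCLT

/-! ### Splitting a measure without atoms -/

/-- A finite measure without atoms takes every intermediate value: after a Borel embedding into
`ℝ`, the distribution function is continuous. -/
theorem exists_measurableSet_measure_eq {Ω : Type*} [MeasurableSpace Ω] [StandardBorelSpace Ω]
    (μ : Measure Ω) [IsFiniteMeasure μ] (h0 : ∀ x, μ {x} = 0) {c : ENNReal} (hc : c ≤ μ Set.univ) :
    ∃ F : Set Ω, MeasurableSet F ∧ μ F = c := by
  rcases hc.eq_or_lt with rfl | hlt
  · exact ⟨Set.univ, .univ, rfl⟩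
  rcases eq_or_ne c 0 with rfl | hc0
  · exact ⟨∅, .empty, measure_empty⟩
  have hctop : c ≠ ⊤ := (hlt.trans_le le_top).ne
  have hμ0 : μ Set.univ ≠ 0 := (hlt.trans_le' zero_le).ne'
  have hμtop : μ Set.univ ≠ ⊤ := measure_ne_top _ _
  have : NeZero μ := ⟨fun h => hμ0 (by simp [h])⟩
  have he : MeasurableEmbedding (embeddingReal Ω) := measurableEmbedding_embeddingReal Ω
  set ρ : Measure ℝ := ((μ Set.univ)⁻¹ • μ).map (embeddingReal Ω) with hρ
  have : IsProbabilityMeasure ρ :=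
    Measure.isProbabilityMeasure_map he.measurable.aemeasurable
  have hatom : ∀ t, ρ {t} = 0 := by
    intro t
    rw [hρ, he.map_apply, Measure.smul_apply, smul_eq_mul]
    have : (embeddingReal Ω ⁻¹' {t}).Subsingleton := fun a ha b hb =>
      he.injective (by rw [Set.mem_preimage, Set.mem_singleton_iff] at ha hb; rw [ha, hb])
    rcases this.eq_empty_or_singleton with h | ⟨x, h⟩ <;> simp [h, h0]
  have hcont : Continuous (cdf ρ) := by
    rw [continuous_iff_continuousAt]
    intro t
    rw [(monotone_cdf ρ).continuousAt_iff_leftLim_eq_rightLim, (cdf ρ).rightLim_eq]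
    have h1 := (cdf ρ).measure_singleton t
    rw [measure_cdf, hatom, eq_comm, ENNReal.ofReal_eq_zero] at h1
    exact le_antisymm ((monotone_cdf ρ).leftLim_le le_rfl) (by linarith)
  have hq : (c / μ Set.univ).toReal < 1 := by
    rw [← ENNReal.toReal_one]
    refine (ENNReal.toReal_lt_toReal ?_ ENNReal.one_ne_top).2 ?_
    · exact ENNReal.div_ne_top hctop hμ0
    · exact (ENNReal.div_lt_iff (Or.inl hμ0) (Or.inl hμtop)).2 (by simpa using hlt)
  have hq0 : 0 < (c / μ Set.univ).toReal := by
    refine ENNReal.toReal_pos (ENNReal.div_pos hc0 hμtop).ne' (ENNReal.div_ne_top hctop hμ0)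
  obtain ⟨t, ht⟩ : (c / μ Set.univ).toReal ∈ Set.range (cdf ρ) := by
    refine mem_range_of_exists_le_of_exists_ge hcont ?_ ?_
    · exact (((tendsto_cdf_atBot ρ).eventually (gt_mem_nhds hq0)).exists).imp fun _ h => h.le
    · exact (((tendsto_cdf_atTop ρ).eventually (lt_mem_nhds hq)).exists).imp fun _ h => h.le
  refine ⟨embeddingReal Ω ⁻¹' Set.Iic t, he.measurable measurableSet_Iic, ?_⟩
  have h2 := ofReal_cdf ρ t
  rw [ht, ENNReal.ofReal_toReal (ENNReal.div_ne_top hctop hμ0), hρ, he.map_apply,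
    Measure.smul_apply, smul_eq_mul, div_eq_mul_inv, mul_comm] at h2
  exact ((ENNReal.mul_right_inj (ENNReal.inv_ne_zero.2 hμtop) (ENNReal.inv_ne_top.2 hμ0)).1 h2).symm

/-- A finite measure without atoms can be split according to any finite probability distribution. -/
theorem exists_map_eq_smul {Ω W : Type*} [MeasurableSpace Ω] [StandardBorelSpace Ω]
    [MeasurableSpace W] [MeasurableSingletonClass W] [Finite W]
    (μ : Measure Ω) [IsFiniteMeasure μ] (h0 : ∀ x, μ {x} = 0)
    (q : Measure W) [IsProbabilityMeasure q] :
    ∃ w : Ω → W, Measurable w ∧ ∀ V : Set W, μ (w ⁻¹' V) = μ Set.univ * q V := by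
  classical
  let _ : MeasurableSpace (Option W) := ⊤
  have : DiscreteMeasurableSpace (Option W) := ⟨fun _ => trivial⟩
  -- The values in `s` have been assigned already; `none` marks the points still to be assigned.
  have key : ∀ s : Finset W, ∃ w : Ω → Option W, Measurable w ∧
      ∀ v, μ (w ⁻¹' {some v}) = if v ∈ s then μ Set.univ * q {v} else 0 := by
    intro s
    induction s using Finset.induction_on with
    | empty => exact ⟨fun _ => none, measurable_const, fun v => by simp⟩
    | insert a s ha ih =>
      obtain ⟨w, hw, hws⟩ := ih
      have hmS : ∀ o : Option W, MeasurableSet (w ⁻¹' {o}) := fun o => hw (.singleton o)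
      have hR : μ (w ⁻¹' {none}) = μ Set.univ * q (s : Set W)ᶜ := by
        have h1 : μ ((w ⁻¹' {none})ᶜ) = μ Set.univ * q s := by
          have : (w ⁻¹' {none})ᶜ = ⋃ v : W, w ⁻¹' {some v} := by
            ext x; simp [Option.ne_none_iff_exists', Set.mem_iUnion]
          have hfin := Fintype.ofFinite W
          rw [this, measure_iUnion _ (fun v => hmS _), tsum_fintype]
          · simp_rw [hws]
            rw [Finset.sum_ite_mem, Finset.univ_inter, ← Finset.mul_sum]
            congr 1
            simp
          · intro v v' hvv
            refine Set.disjoint_left.2 fun x hx hx' => hvv ?_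
            simp only [Set.mem_preimage, Set.mem_singleton_iff] at hx hx'
            exact Option.some_injective _ (hx.symm.trans hx')
        have h2 := prob_add_prob_compl (μ := q) s.measurableSet
        have h3 := measure_add_measure_compl (μ := μ) (hmS none)
        rw [h1] at h3
        refine (ENNReal.add_left_inj (a := μ Set.univ * q s) ?_).1 ?_
        · exact ENNReal.mul_ne_top (measure_ne_top _ _) (measure_ne_top _ _)
        · rw [h3, ← mul_add, add_comm (q _), h2, mul_one]
      obtain ⟨F, hF, hFm⟩ := exists_measurableSet_measure_eq (μ.restrict (w ⁻¹' {none}))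
        (fun x => le_antisymm ((Measure.restrict_apply_le _ _).trans (h0 x).le) zero_le)
        (c := μ Set.univ * q {a}) (by
          rw [Measure.restrict_apply_univ, hR]
          gcongr
          simpa using ha)
      rw [Measure.restrict_apply hF] at hFm
      refine ⟨fun x => if x ∈ F ∩ w ⁻¹' {none} then some a else w x,
        Measurable.ite (hF.inter (hmS none)) measurable_const hw, fun v => ?_⟩
      by_cases hva : v = a
      · subst hva
        rw [if_pos (Finset.mem_insert_self _ _), ← hFm]
        have h0' : μ (w ⁻¹' {some v}) = 0 := by rw [hws, if_neg ha]
        refine le_antisymm ((measure_mono (t := (F ∩ w ⁻¹' {none}) ∪ w ⁻¹' {some v}) ?_).trans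
          ((measure_union_le _ _).trans (by rw [h0', add_zero]))) (measure_mono ?_)
        · intro x hx
          by_cases hxF : x ∈ F ∩ w ⁻¹' {none}
          · exact Or.inl hxF
          · right; simpa only [Set.mem_preimage, if_neg hxF] using hx
        · intro x hx; simp only [Set.mem_preimage, if_pos hx, Set.mem_singleton_iff]
      · have : (fun x => if x ∈ F ∩ w ⁻¹' {none} then some a else w x) ⁻¹' {some v}
            = w ⁻¹' {some v} := by
          ext x
          by_cases hxF : x ∈ F ∩ w ⁻¹' {none}
          · have h2 := hxF.2
            simp only [Set.mem_preimage, Set.mem_singleton_iff] at h2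
            simp only [Set.mem_preimage, if_pos hxF, Set.mem_singleton_iff, h2]
            simp [Ne.symm hva]
          · simp only [Set.mem_preimage, if_neg hxF]
        rw [this, hws]
        simp [Finset.mem_insert, hva]
  have := Fintype.ofFinite W
  obtain ⟨w, hw, hws⟩ := key Finset.univ
  obtain ⟨v0⟩ : Nonempty W := q.nonempty_of_neZero
  have hw' : Measurable fun x => (w x).getD v0 :=
    (measurable_of_countable fun o : Option W => o.getD v0).comp hw
  have hle : ∀ V : Set W, μ Set.univ * q V ≤ μ ((fun x => (w x).getD v0) ⁻¹' V) := by
    intro V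
    calc μ Set.univ * q V = ∑ v ∈ V.toFinset, μ (w ⁻¹' {some v}) := by
          simp_rw [hws, Finset.mem_univ, if_true, ← Finset.mul_sum]
          congr 1
          simp
      _ = μ (w ⁻¹' ((V.toFinset.image some : Finset (Option W)) : Set (Option W))) := by
          rw [← sum_measure_preimage_singleton _ fun y _ => hw (.singleton y), Finset.sum_image]
          exact fun a _ b _ h => Option.some_injective _ h
      _ ≤ _ := by
          refine measure_mono fun x hx => ?_
          simp only [Finset.coe_image, Set.coe_toFinset, Set.mem_preimage, Set.mem_image] at hx
          obtain ⟨v, hv, hx⟩ := hx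
          simp [← hx, hv]
  refine ⟨_, hw', fun V => le_antisymm ?_ (hle V)⟩
  have hV : MeasurableSet V := V.toFinite.measurableSet
  have h1 := hle Vᶜ
  rw [Set.preimage_compl] at h1
  have h2 := measure_add_measure_compl (μ := μ) (hw' hV)
  have h3 := prob_add_prob_compl (μ := q) hV
  have h4 : μ ((fun x => (w x).getD v0) ⁻¹' V) + μ Set.univ * q Vᶜ
      ≤ μ Set.univ * q V + μ Set.univ * q Vᶜ := by
    rw [← mul_add, h3, mul_one]
    exact (add_le_add_right h1 _).trans h2.le
  exact (ENNReal.add_le_add_iff_right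
    (ENNReal.mul_ne_top (measure_ne_top _ _) (measure_ne_top _ _))).1 h4

/-- On a space without atoms there is a random variable of any prescribed finite law that is
independent of each of finitely many given events: split every atom of the generated partition. -/
theorem exists_indep_of_finite_family {Ω W ι : Type*} [MeasurableSpace Ω] [StandardBorelSpace Ω]
    [MeasurableSpace W] [MeasurableSingletonClass W] [Finite W] [Finite ι]
    (μ : Measure Ω) [IsFiniteMeasure μ] (h0 : ∀ x, μ {x} = 0)
    (q : Measure W) [IsProbabilityMeasure q] (C : ι → Set Ω) (hC : ∀ i, MeasurableSet (C i)) :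
    ∃ w : Ω → W, Measurable w ∧ ∀ i, ∀ V : Set W, μ (C i ∩ w ⁻¹' V) = μ (C i) * q V := by
  classical
  let σ : Ω → ι → Prop := fun x i => x ∈ C i
  have hσ : Measurable σ := measurable_pi_lambda _ fun i => measurable_mem.2 (hC i)
  have hfib : ∀ s : Set (ι → Prop), MeasurableSet s := fun s => s.toFinite.measurableSet
  have H := fun s : ι → Prop => exists_map_eq_smul (μ.restrict (σ ⁻¹' {s}))
        (fun x => le_antisymm ((Measure.restrict_apply_le _ _).trans (h0 x).le) zero_le) q
  choose w hw hwV using H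
  have hW : Measurable fun x => w (σ x) x :=
    (measurable_from_prod_countable_right (f := fun p : (ι → Prop) × Ω => w p.1 p.2) hw).comp
      (hσ.prodMk measurable_id)
  refine ⟨_, hW, fun i V => ?_⟩
  have := Fintype.ofFinite ι
  have hV : MeasurableSet V := V.toFinite.measurableSet
  have hsum : ∀ A : Set Ω, MeasurableSet A →
      μ A = ∑ s : ι → Prop, μ (A ∩ σ ⁻¹' {s}) := by
    intro A hA
    have := sum_measure_preimage_singleton (μ := μ.restrict A) (Finset.univ : Finset (ι → Prop))
      (f := σ) fun y _ => hσ (hfib _)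
    rw [Finset.coe_univ, Set.preimage_univ, Measure.restrict_apply_univ] at this
    rw [← this]
    refine Finset.sum_congr rfl fun s _ => ?_
    rw [Measure.restrict_apply (hσ (hfib _)), Set.inter_comm]
  rw [hsum _ ((hC i).inter (hW hV)), hsum _ (hC i), Finset.sum_mul]
  refine Finset.sum_congr rfl fun s _ => ?_
  by_cases hs : s i
  · have h1 : C i ∩ σ ⁻¹' {s} = σ ⁻¹' {s} := by
      refine Set.inter_eq_right.2 fun x hx => ?_
      have : σ x i = s i := congrFun hx i
      exact show σ x i from this ▸ hs
    have h2 : C i ∩ (fun x => w (σ x) x) ⁻¹' V ∩ σ ⁻¹' {s} = w s ⁻¹' V ∩ σ ⁻¹' {s} := by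
      rw [Set.inter_right_comm, h1]
      ext x
      simp only [Set.mem_inter_iff, Set.mem_preimage, Set.mem_singleton_iff]
      constructor
      · rintro ⟨h, h'⟩; exact ⟨h ▸ h', h⟩
      · rintro ⟨h, h'⟩; exact ⟨h', h'.symm ▸ h⟩
    have h3 := hwV s V
    rw [Measure.restrict_apply (hw s hV), Measure.restrict_apply_univ] at h3
    rw [h1, h2, h3]
  · have h1 : C i ∩ σ ⁻¹' {s} = ∅ := by
      refine Set.eq_empty_of_forall_notMem fun x hx => hs ?_
      have : σ x i = s i := congrFun hx.2 i
      exact this ▸ (show σ x i from hx.1)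
    rw [h1, Set.inter_right_comm, h1]
    simp

/-! ### The orbit flow and marker sets -/

/-- The action of `ℤ` on `Ω` by the powers of `T`. -/
def flow {Ω : Type*} [MeasurableSpace Ω] (T : Ω ≃ᵐ Ω) (n : ℤ) (x : Ω) : Ω :=
  ((T.toEquiv : Equiv.Perm Ω) ^ n) x

section Flow

variable {Ω : Type*} [MeasurableSpace Ω] {m : Measure Ω} {T : Ω ≃ᵐ Ω}

@[simp] theorem flow_zero (x : Ω) : flow T 0 x = x := rfl

theorem flow_add (a b : ℤ) (x : Ω) : flow T (a + b) x = flow T a (flow T b x) := by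
  simp [flow, zpow_add]

theorem flow_flow (a b : ℤ) (x : Ω) : flow T a (flow T b x) = flow T (a + b) x :=
  (flow_add a b x).symm

theorem flow_natCast (n : ℕ) (x : Ω) : flow T n x = T^[n] x := by
  rw [flow, zpow_natCast, Equiv.Perm.coe_pow]
  rfl

theorem flow_neg_natCast (n : ℕ) (x : Ω) : flow T (-n) x = T.symm^[n] x := by
  rw [flow, zpow_neg, zpow_natCast, ← inv_pow, Equiv.Perm.coe_pow]
  rfl

theorem measurePreserving_flow (hT : MeasurePreserving T m m) (n : ℤ) :
    MeasurePreserving (flow T n) m m := by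
  obtain ⟨k, rfl | rfl⟩ := n.eq_nat_or_neg
  · rw [funext (flow_natCast k)]
    exact hT.iterate k
  · rw [funext (flow_neg_natCast k)]
    exact (hT.symm T).iterate k

theorem measurable_flow (T : Ω ≃ᵐ Ω) (n : ℤ) : Measurable (flow T n) := by
  obtain ⟨k, rfl | rfl⟩ := n.eq_nat_or_neg
  · rw [funext (flow_natCast k)]
    exact T.measurable.iterate k
  · rw [funext (flow_neg_natCast k)]
    exact T.symm.measurable.iterate k

theorem ae_forall_flow (hT : MeasurePreserving T m m) {P : Ω → Prop} (hP : ∀ᵐ x ∂m, P x) :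
    ∀ᵐ x ∂m, ∀ n : ℤ, P (flow T n x) :=
  ae_all_iff.2 fun n => (measurePreserving_flow hT n).quasiMeasurePreserving.ae hP

theorem Aperiodic.flow_ne (hap : Aperiodic m T) : ∀ᵐ x ∂m, ∀ n : ℤ, n ≠ 0 → flow T n x ≠ x := by
  filter_upwards [hap] with x hx n hn h
  obtain ⟨k, rfl | rfl⟩ := n.eq_nat_or_neg
  · exact hx k (by omega) (by rwa [flow_natCast] at h)
  · refine hx k (by omega) ?_
    rw [← flow_natCast]
    conv_lhs => rw [← h, flow_flow, add_neg_cancel, flow_zero]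

/-- A point of positive mass would have infinitely many translates of the same mass. -/
theorem measure_singleton_of_aperiodic [MeasurableSingletonClass Ω] [IsFiniteMeasure m]
    (hT : MeasurePreserving T m m) (hap : Aperiodic m T) (x : Ω) : m {x} = 0 := by
  by_contra hx
  have hinj : Function.Injective fun n : ℤ => flow T n x := by
    have hx' : ∀ n : ℤ, n ≠ 0 → flow T n x ≠ x := by
      by_contra hcon
      refine hx (measure_mono_null ?_ (ae_iff.1 hap.flow_ne))
      simpa using hcon
    intro a b hab
    by_contra hne
    refine hx' (a - b) (sub_ne_zero.2 hne) ?_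
    have := congrArg (flow T (-b)) hab
    simp only [flow_flow] at this
    rwa [neg_add_cancel, flow_zero, neg_add_eq_sub] at this
  have hpre : ∀ n : ℤ, m {flow T n x} = m {x} := by
    intro n
    rw [← (measurePreserving_flow hT n).measure_preimage
      (measurableSet_singleton _).nullMeasurableSet]
    congr 1
    ext y
    simp only [Set.mem_preimage, Set.mem_singleton_iff]
    refine ⟨fun h => ?_, fun h => h ▸ rfl⟩
    have := congrArg (flow T (-n)) h
    simpa [flow_flow] using this
  have hsum : m (⋃ n : ℤ, {flow T n x}) = ∑' _ : ℤ, m {x} := by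
    rw [measure_iUnion _ fun n => measurableSet_singleton _]
    · simp_rw [hpre]
    · intro a b hab
      simpa using fun h => hab (hinj h)
  rw [ENNReal.tsum_const_eq_top_of_ne_zero hx] at hsum
  exact measure_ne_top _ _ hsum

/-- A marker set: points of `B` on one orbit are at least `h` apart, and almost every point is at
distance less than `h` from `B` along its orbit. The set is built greedily from countably many
sets that are `h`-separated and cover the aperiodic part. -/
theorem exists_marker [StandardBorelSpace Ω] (hap : Aperiodic m T) (h : ℕ) :
    ∃ B : Set Ω, MeasurableSet B ∧
      (∀ x ∈ B, ∀ n : ℤ, 0 < n → n < h → flow T n x ∉ B) ∧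
      ∀ᵐ x ∂m, 0 < h → ∃ n : ℤ, -h < n ∧ n < h ∧ flow T n x ∈ B := by
  have he : MeasurableEmbedding (embeddingReal Ω) := measurableEmbedding_embeddingReal Ω
  set e := embeddingReal Ω
  have hbasis := TopologicalSpace.isBasis_countableBasis ℝ
  obtain ⟨U, hU⟩ := (TopologicalSpace.countable_countableBasis ℝ).exists_eq_range
    ((hbasis.exists_subset_of_mem_open (Set.mem_univ 0) isOpen_univ).imp fun _ h => h.1)
  rw [hU] at hbasis
  have hUo : ∀ k, IsOpen (U k) := fun k => hbasis.isOpen ⟨k, rfl⟩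
  -- `A k` is a set whose translates by `0 < |n| < h` miss it; these sets cover the aperiodic part
  let A : ℕ → Set Ω := fun k => {x | e x ∈ U k ∧ ∀ n : ℤ, n ≠ 0 → -h < n → n < h →
    e (flow T n x) ∉ U k}
  have hA : ∀ k, MeasurableSet (A k) := by
    intro k
    have h1 : ∀ n, MeasurableSet {x | e (flow T n x) ∈ U k} := fun n =>
      (he.measurable.comp (measurable_flow T n)) (hUo k).measurableSet
    have : A k = {x | e (flow T 0 x) ∈ U k} ∩ ⋂ n : ℤ, ⋂ (_ : n ≠ 0 ∧ -h < n ∧ n < h),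
        {x | e (flow T n x) ∈ U k}ᶜ := by
      ext x; simp [A]
    rw [this]
    exact (h1 0).inter (.iInter fun n => .iInter fun _ => (h1 n).compl)
  have hAsep : ∀ k, ∀ x ∈ A k, ∀ n : ℤ, n ≠ 0 → -h < n → n < h → flow T n x ∉ A k :=
    fun k x hx n h0 h1 h2 h3 => hx.2 n h0 h1 h2 h3.1
  -- At step `k`, add the points of `A k` that are far from all points chosen before.
  let B : ℕ → Set Ω := fun k => Nat.rec ∅ (fun k Bk => Bk ∪ {x | x ∈ A k ∧
    ∀ n : ℤ, -h < n → n < h → flow T n x ∉ Bk}) k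
  have hBsucc : ∀ k, B (k + 1) = B k ∪ {x | x ∈ A k ∧
    ∀ n : ℤ, -h < n → n < h → flow T n x ∉ B k} := fun k => rfl
  have hBm : ∀ k, MeasurableSet (B k) := by
    intro k
    induction k with
    | zero => exact .empty
    | succ k ih =>
      have : B (k + 1) = B k ∪ (A k ∩ ⋂ n : ℤ, ⋂ (_ : -h < n ∧ n < h), (flow T n ⁻¹' B k)ᶜ) := by
        rw [hBsucc]; ext x; simp
      rw [this]
      exact ih.union ((hA k).inter (.iInter fun n => .iInter fun _ =>
        (measurable_flow T n ih).compl))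
  have hBmono : Monotone B := monotone_nat_of_le_succ fun k => by
    rw [hBsucc]; exact Set.subset_union_left
  have hBsep : ∀ k, ∀ x ∈ B k, ∀ n : ℤ, n ≠ 0 → -h < n → n < h → flow T n x ∉ B k := by
    intro k
    induction k with
    | zero => exact fun x hx => hx.elim
    | succ k ih =>
      intro x hx n h0 h1 h2 hn
      rw [hBsucc] at hx hn
      rcases hx with hx | hx <;> rcases hn with hn | hn
      · exact ih x hx n h0 h1 h2 hn
      · refine hn.2 (-n) (by omega) (by omega) ?_
        rwa [flow_flow, neg_add_cancel, flow_zero]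
      · exact hx.2 n h1 h2 hn
      · exact hAsep k x hx.1 n h0 h1 h2 hn.1
  refine ⟨⋃ k, B k, .iUnion hBm, ?_, ?_⟩
  · intro x hx n h1 h2 hn
    obtain ⟨a, ha⟩ := Set.mem_iUnion.1 hx
    obtain ⟨b, hb⟩ := Set.mem_iUnion.1 hn
    exact hBsep (max a b) x (hBmono (le_max_left _ _) ha) n h1.ne' (by omega) h2
      (hBmono (le_max_right _ _) hb)
  · filter_upwards [hap.flow_ne] with x hx hh
    obtain ⟨k, hk⟩ : ∃ k, x ∈ A k := by
      have hfin : ((fun n : ℤ => e (flow T n x)) '' {n | n ≠ 0 ∧ -h < n ∧ n < h}).Finite :=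
        ((Set.finite_Ioo (-h : ℤ) h).subset fun n hn => hn.2).image _
      obtain ⟨_, ⟨k, rfl⟩, hk, hkF⟩ := hbasis.exists_subset_of_mem_open (a := e x)
        (u := ((fun n : ℤ => e (flow T n x)) '' {n | n ≠ 0 ∧ -h < n ∧ n < h})ᶜ)
        (by
          rintro ⟨n, hn, hne⟩
          exact hx n hn.1 (he.injective hne)) hfin.isClosed.isOpen_compl
      exact ⟨k, hk, fun n h0 h1 h2 hn => hkF hn ⟨n, ⟨h0, h1, h2⟩, rfl⟩⟩
    rcases em (∃ n : ℤ, -h < n ∧ n < h ∧ flow T n x ∈ B k) with hex | hex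
    · obtain ⟨n, h1, h2, h3⟩ := hex
      exact ⟨n, h1, h2, Set.mem_iUnion.2 ⟨k, h3⟩⟩
    · refine ⟨0, by omega, by omega, Set.mem_iUnion.2 ⟨k + 1, Or.inr ⟨hk, fun n h1 h2 h3 => ?_⟩⟩⟩
      exact hex ⟨n, h1, h2, h3⟩

end Flow

/-! ### Measures on words, hitting times and the code -/

/-- A probability measure with an atom at `w₀` of mass at least `t` is a mixture with weight `t` on
the point mass at `w₀`. -/
theorem exists_eq_smul_dirac_add_smul {W : Type*} [MeasurableSpace W] [MeasurableSingletonClass W]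
    (μ : Measure W) [IsProbabilityMeasure μ] (w₀ : W) {t : ENNReal} (ht : t ≤ μ {w₀})
    (ht1 : t < 1) :
    ∃ κ : Measure W, IsProbabilityMeasure κ ∧ μ = t • Measure.dirac w₀ + (1 - t) • κ := by
  have htop : t ≠ ⊤ := (ht1.trans ENNReal.one_lt_top).ne
  have h1t : 1 - t ≠ 0 := (tsub_pos_of_lt ht1).ne'
  have h1t' : 1 - t ≠ ⊤ := ENNReal.sub_ne_top ENNReal.one_ne_top
  have hfin : IsFiniteMeasure (t • Measure.dirac w₀) := Measure.smul_finite _ htop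
  have hle : t • Measure.dirac w₀ ≤ μ := by
    refine Measure.le_iff.2 fun s hs => ?_
    rw [Measure.smul_apply, Measure.dirac_apply' _ hs, smul_eq_mul]
    by_cases h : w₀ ∈ s
    · simpa [h] using ht.trans (measure_mono (Set.singleton_subset_iff.2 h))
    · simp [h]
  refine ⟨(1 - t)⁻¹ • (μ - t • Measure.dirac w₀), ⟨?_⟩, ?_⟩
  · rw [Measure.smul_apply, Measure.sub_apply .univ hle, Measure.smul_apply, smul_eq_mul,
      smul_eq_mul, measure_univ, measure_univ, mul_one, ENNReal.inv_mul_cancel h1t h1t']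
  · rw [smul_smul, ENNReal.mul_inv_cancel h1t h1t', one_smul, add_comm,
      Measure.sub_add_cancel_of_le hle]

/-- The probability of prescribing some coordinates, selected injectively, of an i.i.d. word. -/
theorem pi_setOf_forall_eq {I J A : Type*} [Fintype J] [MeasurableSpace A]
    [MeasurableSingletonClass A] (ν : Measure A) [IsProbabilityMeasure ν] {e : I → J}
    (he : Function.Injective e) (s : Finset I) (u : I → A) :
    Measure.pi (fun _ : J => ν) {v | ∀ i ∈ s, v (e i) = u i} = ∏ i ∈ s, ν {u i} := by
  have h1 : iIndepFun (fun (j : J) (v : J → A) => v j) (Measure.pi fun _ : J => ν) :=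
    iIndepFun_pi (X := fun _ a => a) fun _ => aemeasurable_id
  have h2 := (h1.precomp he).measure_inter_preimage_eq_mul s (sets := fun i => {u i})
    fun i _ => measurableSet_singleton _
  convert h2 using 1
  · congr 1; ext v; simp
  · refine Finset.prod_congr rfl fun i _ => ?_
    exact ((measurePreserving_eval (fun _ : J => ν) (e i)).measure_preimage
      (measurableSet_singleton _).nullMeasurableSet).symm

theorem measure_eq_mul_of_fibers {Ω ι : Type*} [MeasurableSpace Ω] [Countable ι]
    [MeasurableSpace ι] [MeasurableSingletonClass ι] {m : Measure Ω} {φ : Ω → ι}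
    (hφ : Measurable φ) {X Y : Set Ω} {c : ENNReal}
    (h : ∀ i, m (X ∩ φ ⁻¹' {i}) = m (Y ∩ φ ⁻¹' {i}) * c) : m X = m Y * c := by
  have hsum : ∀ Z : Set Ω, m Z = ∑' i, m (Z ∩ φ ⁻¹' {i}) := by
    intro Z
    have h1 : m.restrict Z Set.univ = ∑' i, m.restrict Z (φ ⁻¹' {i}) := by
      rw [← measure_iUnion _ fun i => hφ (.singleton i)]
      · congr 1; ext x; simp
      · intro i j hij
        refine Set.disjoint_left.2 fun x hx hx' => hij ?_
        exact (show φ x = i from hx).symm.trans hx'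
    rw [Measure.restrict_apply_univ] at h1
    rw [h1]
    refine tsum_congr fun i => ?_
    rw [Measure.restrict_apply (hφ (.singleton i)), Set.inter_comm]
  rw [hsum X, hsum Y, ← ENNReal.tsum_mul_right]
  exact tsum_congr h

section Hit

variable {Ω : Type*} [MeasurableSpace Ω] {T : Ω ≃ᵐ Ω}

open Classical in
/-- The least `k` with `T ^ (b k) x ∈ s`, capped at `K`. -/
noncomputable def hit (T : Ω ≃ᵐ Ω) (s : Set Ω) (b : ℕ → ℤ) (K : ℕ) (x : Ω) : ℕ :=
  Nat.find (p := fun k => flow T (b k) x ∈ s ∨ k = K) ⟨K, Or.inr rfl⟩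

variable {s : Set Ω} {b : ℕ → ℤ} {K k : ℕ} {x : Ω}

theorem measurable_hit (hs : MeasurableSet s) (b : ℕ → ℤ) (K : ℕ) : Measurable (hit T s b K) := by
  classical
  refine measurable_find (p := fun x k => flow T (b k) x ∈ s ∨ k = K) _ fun k => ?_
  exact (measurable_flow T (b k) hs).union (.const _)

theorem hit_le : hit T s b K x ≤ K := by
  classical
  exact Nat.find_min' _ (Or.inr rfl)

theorem flow_hit_mem (h : hit T s b K x < K) : flow T (b (hit T s b K x)) x ∈ s := by
  classical
  exact (Nat.find_spec (p := fun k => flow T (b k) x ∈ s ∨ k = K) ⟨K, Or.inr rfl⟩).resolve_right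
    h.ne

theorem flow_notMem_of_lt_hit (h : k < hit T s b K x) : flow T (b k) x ∉ s := by
  classical
  exact fun hk => Nat.find_min (p := fun k => flow T (b k) x ∈ s ∨ k = K) _ h (Or.inl hk)

theorem hit_eq_of_mem (hK : k ≤ K) (h : flow T (b k) x ∈ s) (hlt : ∀ j < k, flow T (b j) x ∉ s) :
    hit T s b K x = k := by
  classical
  refine (Nat.find_eq_iff _).2 ⟨Or.inl h, fun j hj hj' => ?_⟩
  rcases hj' with hj' | rfl
  · exact hlt j hj hj'
  · exact absurd hj (by omega)

theorem hit_eq_cap (hlt : ∀ j < K, flow T (b j) x ∉ s) : hit T s b K x = K := by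
  refine le_antisymm hit_le (not_lt.1 fun h => hlt _ h (flow_hit_mem h))

/-- If the hitting time is not capped, it is determined by the first visit. -/
theorem hit_eq_of_lt (hK : hit T s b K x < K) (h : flow T (b k) x ∈ s)
    (hlt : ∀ j < k, flow T (b j) x ∉ s) : hit T s b K x = k := by
  refine hit_eq_of_mem (not_lt.1 fun hk => ?_) h hlt
  exact hlt _ (hK.trans hk) (flow_hit_mem hK)

end Hit

section Code

variable {Ω A : Type*} [MeasurableSpace Ω] {T : Ω ≃ᵐ Ω}

/-- The sequence of times `0, -1, -2, …`; along it, `hit` is the time since the last visit. -/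
abbrev past (k : ℕ) : ℤ := -k

/-- The symbol at `x`. Let `y` be the last visit to `B` before `x`; it carries the pair of words
`w y`. The `L` positions from a point of `B` on show the constant symbol `a₀`, those from a point of
`D` outside `B` on show the second word of `y`, and all other positions show the first word of `y`,
read periodically. -/
noncomputable def code (T : Ω ≃ᵐ Ω) (B D : Set Ω) (L K : ℕ) (a₀ : A)
    (w : Ω → (ZMod L → A) × (ZMod L → A)) (x : Ω) : A :=
  if hit T B past K x < L then a₀
  else if hit T D past L x < L then
    (w (flow T (past (hit T B past K x)) x)).2 (hit T D past L x)
  else (w (flow T (past (hit T B past K x)) x)).1 (hit T B past K x)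

open Classical in
/-- The symbols seen in the window `0 ≤ i < L` from `x`. Here `a` is the position of the only point
of `D` at distance less than `L` from `x`, and `a = L` if there is none. The window never shows
words of two different points of `B`: between such words it would have to contain the whole constant
segment of length `L` and one more position on each side. -/
theorem code_flow {B D : Set Ω} {L K : ℕ} {a₀ : A} {w : Ω → (ZMod L → A) × (ZMod L → A)} {x : Ω}
    (hBD : B ⊆ D) (hD : ∀ y ∈ D, ∀ n : ℤ, 0 < n → n < 3 * L → flow T n y ∉ D)
    (hgood : ∀ n : ℤ, hit T B past K (flow T n x) < K) {a : ℤ}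
    (ha : (a = L ∧ ∀ b : ℤ, -L < b → b < L → flow T b x ∉ D) ∨
      (-L < a ∧ a < L ∧ flow T a x ∈ D)) {i : ℕ} (hi : i < L) :
    code T B D L K a₀ w (flow T i x) =
      if a ≤ i ∧ i < a + L then
        if flow T a x ∈ B then a₀
        else (w (flow T (past (hit T B past K x)) x)).2 ((i - a : ℤ) : ZMod L)
      else (w (flow T (past (hit T B past K x)) x)).1
        ((hit T B past K x + i : ℕ) : ZMod L) := by
  have huniq : ∀ b : ℤ, -L < b → b < L → flow T b x ∈ D → b = a := by
    intro b hb1 hb2 hb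
    rcases ha with ⟨-, h⟩ | ⟨h1, h2, h3⟩
    · exact absurd hb (h b hb1 hb2)
    · rcases lt_trichotomy a b with hab | hab | hab
      · refine absurd hb ?_
        have := hD _ h3 (b - a) (by omega) (by omega)
        rwa [flow_flow, sub_add_cancel] at this
      · exact hab.symm
      · refine absurd h3 ?_
        have := hD _ hb (a - b) (by omega) (by omega)
        rwa [flow_flow, sub_add_cancel] at this
  have haL : a ≤ L := by omega
  have haD : a < L → -L < a ∧ flow T a x ∈ D := by
    intro h; rcases ha with ⟨h', -⟩ | ⟨h1, h2, h3⟩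
    · omega
    · exact ⟨h1, h3⟩
  set n := hit T B past K x with hn
  have hnK : n < K := by simpa using hgood 0
  have hnB : flow T (past n) x ∈ B := flow_hit_mem hnK
  have hnmin : ∀ b : ℤ, -(n : ℤ) < b → b ≤ 0 → flow T b x ∉ B := by
    intro b hb1 hb2
    have := flow_notMem_of_lt_hit (T := T) (s := B) (b := past) (K := K) (x := x)
      (k := b.natAbs) (by omega)
    rwa [show past b.natAbs = b by simp only [past]; omega] at this
  -- the last visit to `B` before time `i`
  have hlast : ∀ c : ℤ, c ≤ i → flow T c x ∈ B → (∀ b : ℤ, c < b → b ≤ i → flow T b x ∉ B) →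
      hit T B past K (flow T i x) = (i - c).toNat := by
    intro c hc hcB hmin
    refine hit_eq_of_lt (hgood i) ?_ fun j hj => ?_
    · rw [flow_flow]
      rwa [show past (i - c).toNat + i = c by simp only [past]; omega]
    · rw [flow_flow]
      exact hmin _ (by simp only [past]; omega) (by simp only [past]; omega)
  have hcast : past (n + i) + i = past n := by simp only [past]; push_cast; ring
  by_cases hseg : a ≤ i ∧ i < a + L
  · obtain ⟨h1, h2⟩ := hseg
    obtain ⟨haL', haD'⟩ := haD (by omega)
    rw [if_pos ⟨h1, h2⟩]
    by_cases hβ : flow T a x ∈ B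
    · have hh := hlast a h1 hβ fun b hb1 hb2 hb => hb1.ne'
        (huniq b (by omega) (by omega) (hBD hb))
      rw [if_pos hβ, code, if_pos (by omega)]
    · have hh : hit T B past K (flow T i x) = n + i :=
        (hlast (-n) (by omega) hnB fun b hb1 hb2 hb => by
        by_cases hb0 : b ≤ 0
        · exact hnmin b hb1 hb0 hb
        · exact hβ (huniq b (by omega) (by omega) (hBD hb) ▸ hb)).trans (by omega)
      have hnL : L ≤ n := by
        by_contra hnL
        exact hβ (huniq (-n) (by omega) (by omega) (hBD hnB) ▸ hnB)
      have hd : hit T D past L (flow T i x) = (i - a).toNat := by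
        refine hit_eq_of_mem (by omega) ?_ fun j hj hjD => ?_
        · rw [flow_flow]
          rwa [show past (i - a).toNat + i = a by simp only [past]; omega]
        · rw [flow_flow] at hjD
          have := huniq _ (by simp only [past]; omega) (by simp only [past]; omega) hjD
          simp only [past] at this
          omega
      rw [if_neg hβ, code, if_neg (by omega), if_pos (by omega), flow_flow, hh, hd]
      rw [hcast, show ((i - a : ℤ) : ZMod L) = ((i - a).toNat : ZMod L) by
        rw [← Int.cast_natCast (i - a).toNat, Int.toNat_of_nonneg (by omega)]]
  · rw [if_neg hseg]
    have hh : hit T B past K (flow T i x) = n + i :=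
      (hlast (-n) (by omega) hnB fun b hb1 hb2 hb => by
      by_cases hb0 : b ≤ 0
      · exact hnmin b hb1 hb0 hb
      · have := huniq b (by omega) (by omega) (hBD hb)
        omega).trans (by omega)
    have hnL : L ≤ n + i := by
      by_contra hnL
      have := huniq (-n) (by omega) (by omega) (hBD hnB)
      omega
    have hd : hit T D past L (flow T i x) = L := by
      refine hit_eq_cap fun j hj hjD => ?_
      rw [flow_flow] at hjD
      have := huniq _ (by simp only [past]; omega) (by simp only [past]; omega) hjD
      simp only [past] at this
      omega
    rw [code, if_neg (by omega), if_neg (by omega), flow_flow, hh]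
    rw [hcast]
end Code

/-! ### Nested marker sets -/

section Nested

variable {Ω : Type*} [MeasurableSpace Ω] {m : Measure Ω} {T : Ω ≃ᵐ Ω}

theorem measurable_comp_flow_hit {β : Type*} [MeasurableSpace β] {f : Ω → β} (hf : Measurable f)
    {s : Set Ω} (hs : MeasurableSet s) (b : ℕ → ℤ) (K : ℕ) :
    Measurable fun x => f (flow T (b (hit T s b K x)) x) :=
  (measurable_from_prod_countable_right (f := fun p : ℕ × Ω => f (flow T (b p.1) p.2)) fun k =>
    hf.comp (measurable_flow T (b k))).comp ((measurable_hit hs b K).prodMk measurable_id)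

theorem measure_flow_preimage (hT : MeasurePreserving T m m) (n : ℤ) {s : Set Ω}
    (hs : MeasurableSet s) : m (flow T n ⁻¹' s) = m s :=
  (measurePreserving_flow hT n).measure_preimage hs.nullMeasurableSet

/-- Two marker sets `B ⊆ D`, with `D` separated and `B` of bounded gaps, such that a point of `D`
lies in `B` with probability exactly `1 / r`, independently of the values of `G` nearby: attach `r`
points of `D` to each point of a sparse marker set and choose one of them uniformly at random,
independently of what `G` shows around it. -/
theorem exists_nested_markers [StandardBorelSpace Ω] [IsFiniteMeasure m]
    (hT : MeasurePreserving T m m) (hap : Aperiodic m T)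
    {S : Type*} [Finite S] [MeasurableSpace S] [MeasurableSingletonClass S] {G : Ω → S}
    (hG : Measurable G) {L r : ℕ} (hL : 0 < L) (hr : 0 < r) :
    ∃ (B D : Set Ω) (K : ℕ), MeasurableSet B ∧ MeasurableSet D ∧ B ⊆ D ∧
      (∀ y ∈ D, ∀ n : ℤ, 0 < n → n < 3 * L → flow T n y ∉ D) ∧
      (∀ᵐ x ∂m, ∀ n : ℤ, hit T B past K (flow T n x) < K) ∧
      ∀ (c : S) (a : ℤ), -L < a → a < L →
        m ({x | G x = c} ∩ flow T a ⁻¹' D ∩ flow T a ⁻¹' B) =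
          m ({x | G x = c} ∩ flow T a ⁻¹' D) * (r : ENNReal)⁻¹ := by
  classical
  have : NeZero r := ⟨hr.ne'⟩
  have h0 := measure_singleton_of_aperiodic hT hap
  obtain ⟨B₀, hB₀, hsep, hsyn⟩ := exists_marker hap (3 * L * r)
  have hh : 0 < 3 * L * r := by positivity
  let idx : ℕ → ℤ := fun i => -(3 * L * i : ℕ)
  obtain ⟨j, hj, hjC⟩ := exists_indep_of_finite_family m h0
    (PMF.uniformOfFintype (Fin r)).toMeasure
    (fun p : Fin r × Set.Ioo (-L : ℤ) L × S =>
      B₀ ∩ {x | G (flow T ((3 * L * p.1 : ℕ) - p.2.1) x) = p.2.2})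
    fun p => hB₀.inter ((hG.comp (measurable_flow T _)) (measurableSet_singleton p.2.2))
  have hidx : ∀ i < r, ∀ x, hit T B₀ idx r x = i ↔ flow T (idx i) x ∈ B₀ := by
    intro i hi x
    constructor
    · rintro rfl
      exact flow_hit_mem hi
    · intro hx
      refine hit_eq_of_mem hi.le hx fun k hk hkx => ?_
      have h1 : 3 * L * k + 3 * L ≤ 3 * L * i := by
        calc 3 * L * k + 3 * L = 3 * L * (k + 1) := by ring
          _ ≤ 3 * L * i := Nat.mul_le_mul_left _ hk
      have h2 : 3 * L * i ≤ 3 * L * r := Nat.mul_le_mul_left _ hi.le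
      have h3 : 3 * L * i < 3 * L * r := Nat.mul_lt_mul_of_pos_left hi (by positivity)
      refine hsep _ hx ((3 * L * i : ℕ) - (3 * L * k : ℕ)) (by omega) (by omega) ?_
      rw [flow_flow]
      rwa [show ((3 * L * i : ℕ) : ℤ) - (3 * L * k : ℕ) + idx i = idx k by simp only [idx]; ring]
  -- `D` consists of the translates by `3 * L * i`, `i < r`, of the points of `B₀`; the translate
  -- with `i = j y` of `y ∈ B₀` belongs to `B`.
  let D : Set Ω := {x | hit T B₀ idx r x < r}
  let B : Set Ω := {x | hit T B₀ idx r x < r ∧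
    (j (flow T (idx (hit T B₀ idx r x)) x) : ℕ) = hit T B₀ idx r x}
  have hhit := measurable_hit (T := T) hB₀ idx r
  have hD : MeasurableSet D := measurableSet_lt hhit measurable_const
  have hB : MeasurableSet B := hD.inter (measurableSet_eq_fun
    (measurable_comp_flow_hit (f := fun x => (j x : ℕ))
      ((measurable_of_countable _).comp hj) hB₀ idx r) hhit)
  refine ⟨B, D, 3 * (3 * L * r), hB, hD, fun x hx => hx.1, ?_, ?_, ?_⟩
  · intro y hy n hn0 hn hny
    have hy' := flow_hit_mem hy
    have hny' := flow_hit_mem hny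
    have hy2 : hit T B₀ idx r y < r := hy
    have hny2 : hit T B₀ idx r (flow T n y) < r := hny
    generalize hit T B₀ idx r y = i at hy' hy2
    generalize hit T B₀ idx r (flow T n y) = i' at hny' hny2
    rw [flow_flow] at hny'
    have h1 : 3 * L * i + 3 * L ≤ 3 * L * r := Nat.mul_le_mul_left (3 * L) hy2
    have h2 : 3 * L * i' + 3 * L ≤ 3 * L * r := Nat.mul_le_mul_left (3 * L) hny2
    have h4 : ∀ s t : ℤ, flow T s y ∈ B₀ → flow T t y ∈ B₀ → s < t →
        t - s < (3 * L * r : ℕ) → False := by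
      intro s t hs ht h1 h2
      refine hsep _ hs (t - s) (by omega) h2 ?_
      rwa [flow_flow, sub_add_cancel]
    rcases lt_trichotomy (idx i) (idx i' + n) with h | h | h
    · exact h4 _ _ hy' hny' h (by simp only [idx]; omega)
    · -- equal base points: `n` is then a nonzero multiple of `3 * L`
      have h5 : (n : ℤ) = (3 * L : ℕ) * ((i' : ℤ) - i) := by
        have h6 : n = idx i - idx i' := by omega
        rw [h6]; simp only [idx]; push_cast; ring
      have h6 : (n : ℤ) < (3 * L : ℕ) * 1 := by push_cast; linarith
      rw [h5] at h6 hn0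
      have h7 := lt_of_mul_lt_mul_left h6 (by positivity)
      have h8 := pos_of_mul_pos_right hn0 (by positivity)
      omega
    · exact h4 _ _ hny' hy' h (by simp only [idx]; omega)
  · filter_upwards [ae_forall_flow hT hsyn] with x hx n
    obtain ⟨b, hb1, hb2, hb⟩ := hx (n - 2 * (3 * L * r : ℕ)) hh
    rw [flow_flow] at hb
    have hi := (j (flow T (b + (n - 2 * (3 * L * r : ℕ))) x)).isLt
    set i : ℕ := (j (flow T (b + (n - 2 * (3 * L * r : ℕ))) x)).val with hidef
    have h1 : 3 * L * i < 3 * L * r := Nat.mul_lt_mul_of_pos_left hi (by positivity)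
    have hmem : flow T ((3 * L * i : ℕ) + (b + (n - 2 * (3 * L * r : ℕ)))) x ∈ B := by
      have h2 : flow T (idx i) (flow T ((3 * L * i : ℕ) + (b + (n - 2 * (3 * L * r : ℕ)))) x) =
          flow T (b + (n - 2 * (3 * L * r : ℕ))) x := by
        rw [flow_flow]; congr 1; simp only [idx]; ring
      have h3 : hit T B₀ idx r (flow T ((3 * L * i : ℕ) + (b + (n - 2 * (3 * L * r : ℕ)))) x)
          = i := (hidx i hi _).2 (h2 ▸ hb)
      refine ⟨h3.symm ▸ hi, ?_⟩
      rw [h3, h2]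
    by_contra hcon
    refine flow_notMem_of_lt_hit (T := T) (s := B) (b := past) (K := 3 * (3 * L * r))
      (x := flow T n x) (k := (2 * (3 * L * r : ℕ) - b - (3 * L * i : ℕ)).toNat) (by omega) ?_
    rw [flow_flow]
    rwa [show past (2 * ((3 * L * r : ℕ) : ℤ) - b - (3 * L * i : ℕ)).toNat + n =
      (3 * L * i : ℕ) + (b + (n - 2 * (3 * L * r : ℕ))) by simp only [past]; omega]
  · intro c a ha1 ha2
    have hGc : ∀ n, MeasurableSet {x | G (flow T n x) = c} := fun n =>
      (hG.comp (measurable_flow T n)) (measurableSet_singleton c)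
    -- translate by `-a`, so that the marker in question is at the origin
    have e1 : {x | G x = c} ∩ flow T a ⁻¹' D =
        flow T a ⁻¹' ({x | G (flow T (-a) x) = c} ∩ D) := by
      ext x; simp [flow_flow]
    rw [e1, ← Set.preimage_inter, measure_flow_preimage hT _ (((hGc _).inter hD).inter hB),
      measure_flow_preimage hT _ ((hGc _).inter hD)]
    refine measure_eq_mul_of_fibers hhit fun i => ?_
    by_cases hi : i < r
    · have e2 : {x | G (flow T (-a) x) = c} ∩ D ∩ hit T B₀ idx r ⁻¹' {i} =
          flow T (idx i) ⁻¹' (B₀ ∩ {x | G (flow T ((3 * L * i : ℕ) - a) x) = c}) := by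
        ext x
        have e3 : (3 * L * i : ℕ) - a + idx i = -a := by simp only [idx]; ring
        simp only [Set.mem_inter_iff, Set.mem_ofPred_eq, Set.mem_preimage, Set.mem_singleton_iff,
          D, hidx i hi, flow_flow, e3]
        constructor
        · exact fun h => ⟨h.2, h.1.1⟩
        · exact fun h => ⟨⟨h.2, by rw [(hidx i hi x).2 h.1]; exact hi⟩, h.1⟩
      have e4 : {x | G (flow T (-a) x) = c} ∩ D ∩ B ∩ hit T B₀ idx r ⁻¹' {i} =
          flow T (idx i) ⁻¹' (B₀ ∩ {x | G (flow T ((3 * L * i : ℕ) - a) x) = c} ∩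
            j ⁻¹' {⟨i, hi⟩}) := by
        rw [Set.inter_right_comm, e2, Set.preimage_inter (t := j ⁻¹' _)]
        ext x
        refine and_congr_right fun hx => ?_
        have h1 := (hidx i hi x).2 hx.1
        simp only [B, Set.mem_ofPred_eq, h1, hi, true_and, Set.mem_preimage,
          Set.mem_singleton_iff, Fin.ext_iff]
      rw [e4, e2, measure_flow_preimage hT _ (hB₀.inter (hGc _)),
        measure_flow_preimage hT _ ((hB₀.inter (hGc _)).inter (hj (measurableSet_singleton _)))]
      have := hjC (⟨i, hi⟩, ⟨a, ha1, ha2⟩, c) {⟨i, hi⟩}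
      rw [this]
      congr 1
      rw [PMF.toMeasure_apply_singleton _ _ (measurableSet_singleton _)]
      simp
    · have e2 : {x | G (flow T (-a) x) = c} ∩ D ∩ hit T B₀ idx r ⁻¹' {i} = ∅ := by
        refine Set.eq_empty_of_forall_notMem fun x hx => hi ?_
        have h1 : hit T B₀ idx r x = i := hx.2
        exact h1 ▸ hx.1.2
      rw [Set.inter_right_comm, e2]
      simp

end Nested

/-! ### Independent symbols on a window of times -/

section Law

variable {Ω A : Type*} [MeasurableSpace Ω] {m : Measure Ω} {T : Ω ≃ᵐ Ω}

theorem measurable_code [Finite A] [MeasurableSpace A] [MeasurableSingletonClass A]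
    {B D : Set Ω} (hB : MeasurableSet B) (hD : MeasurableSet D) {L : ℕ} [NeZero L] (K : ℕ) (a₀ : A)
    {w : Ω → (ZMod L → A) × (ZMod L → A)} (hw : Measurable w) :
    Measurable (code T B D L K a₀ w) := by
  have h1 := measurable_hit (T := T) hB past K
  have h2 := measurable_hit (T := T) hD past L
  have h3 := measurable_comp_flow_hit (T := T) hw hB past K
  exact (measurable_of_countable fun p : ((ZMod L → A) × (ZMod L → A)) × ℕ × ℕ =>
    if p.2.1 < L then a₀ else if p.2.2 < L then p.1.2 p.2.2 else p.1.1 p.2.1).comp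
      (h3.prodMk (h1.prodMk h2))

/-- The sequence of times `-L + 1, …, L - 1, L, …` around the origin. -/
abbrev window (L k : ℕ) : ℤ := k + 1 - L

/-- For every finite-valued `G`, every law `ν` on a finite alphabet and every `L` there is a
function `g` such that `g, g ∘ T, …, g ∘ T ^ (L - 1)` are i.i.d. with law `ν` and jointly
independent of `G`. -/
theorem exists_iid_window [StandardBorelSpace Ω] [IsProbabilityMeasure m]
    (hT : MeasurePreserving T m m) (hap : Aperiodic m T)
    {S : Type*} [Finite S] [MeasurableSpace S] [MeasurableSingletonClass S] {G : Ω → S}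
    (hG : Measurable G) [Finite A] [MeasurableSpace A] [MeasurableSingletonClass A]
    (ν : Measure A) [IsProbabilityMeasure ν] {a₀ : A} (ha₀ : ν {a₀} ≠ 0) {L : ℕ} (hL : 0 < L) :
    ∃ g : Ω → A, Measurable g ∧ ∀ (c : S) (u : Fin L → A),
      m {x | G x = c ∧ ∀ i : Fin L, g (flow T (i : ℕ) x) = u i} =
        m {x | G x = c} * ∏ i, ν {u i} := by
  classical
  have : NeZero L := ⟨hL.ne'⟩
  have := Fintype.ofFinite A
  -- Words are indexed by `ZMod L`, so that a window of length `L` reads each letter at most once,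
  -- wherever it starts.
  let P : Measure (ZMod L → A) := Measure.pi fun _ => ν
  have hP0 : P {fun _ => a₀} ≠ 0 := by
    rw [Measure.pi_singleton]
    exact Finset.prod_ne_zero_iff.2 fun _ _ => ha₀
  obtain ⟨r', hr'⟩ := ENNReal.exists_inv_nat_lt hP0
  set r := max r' 2
  have hr2 : 2 ≤ r := le_max_right _ _
  set t : ENNReal := (r : ENNReal)⁻¹
  have htP : t ≤ P {fun _ => a₀} :=
    (ENNReal.inv_le_inv.2 (by exact_mod_cast le_max_left _ _)).trans hr'.le
  have ht1 : t < 1 := ENNReal.inv_lt_one.2 (by exact_mod_cast hr2)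
  obtain ⟨κ, hκ, hPκ⟩ := exists_eq_smul_dirac_add_smul P (fun _ => a₀) htP ht1
  obtain ⟨B, D, K, hB, hD, hBD, hsep, hgood, hBt⟩ :=
    exists_nested_markers hT hap hG hL (r := r) (by omega)
  -- `N x` encodes the offset in `(-L, L)` of the marker in `D` next to `x`, if there is one
  set N : Ω → ℕ := hit T D (window L) (2 * L - 1)
  have hN : Measurable N := measurable_hit hD _ _
  set H : Ω → ℕ := hit T B past K
  have hH : Measurable H := measurable_hit hB _ _
  let F : ℕ → Bool → Set Ω := fun k β => {x | β = true ↔ flow T (window L k) x ∈ B}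
  have hF : ∀ k β, MeasurableSet (F k β) := fun k β =>
    measurableSet_setOfPred.2 (measurable_const.iff
      (measurable_mem.2 hB |>.comp (measurable_flow T _)))
  have hGc : ∀ c, MeasurableSet {x | G x = c} := fun c => hG (measurableSet_singleton c)
  -- A cell records the value of `G` and the position of the window relative to `D` and `B`. Given
  -- the cell, the window is a function of the pair of words at the last visit to `B`, and these
  -- words are chosen independently of the finitely many cells.
  let cell : ℕ → Bool → ℕ → S → Set Ω := fun k β n c =>
    {x | G x = c} ∩ N ⁻¹' {k} ∩ F k β ∩ H ⁻¹' {n}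
  have hcell : ∀ k β n c, MeasurableSet (cell k β n c) := fun k β n c =>
    (((hGc c).inter (hN (.singleton k))).inter (hF k β)).inter (hH (.singleton n))
  obtain ⟨w, hw, hwC⟩ := exists_indep_of_finite_family m
    (measure_singleton_of_aperiodic hT hap) (P.prod κ)
    (fun p : Fin (2 * L) × Bool × Fin (K + 1) × S =>
      flow T (p.2.2.1 : ℕ) ⁻¹' cell p.1 p.2.1 p.2.2.1 p.2.2.2)
    fun p => measurable_flow T _ (hcell _ _ _ _)
  refine ⟨code T B D L K a₀ w, measurable_code hB hD K a₀ hw, fun c u => ?_⟩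
  set E : Set Ω := {x | ∀ i : Fin L, code T B D L K a₀ w (flow T (i : ℕ) x) = u i}
  have hEm : MeasurableSet E := by
    have : E = ⋂ i : Fin L, (fun x => code T B D L K a₀ w (flow T (i : ℕ) x)) ⁻¹' {u i} := by
      ext x; simp [E]
    rw [this]
    exact .iInter fun i => ((measurable_code hB hD K a₀ hw).comp (measurable_flow T _))
      (measurableSet_singleton _)
  -- the positions of the window covered by the segment attached to the marker
  let seg : ℕ → Finset (Fin L) := fun k =>
    {i | window L k ≤ (i : ℕ) ∧ ((i : ℕ) : ℤ) < window L k + L}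
  let V₁ : ℕ → ℕ → Set (ZMod L → A) := fun k n =>
    {v | ∀ i ∈ (seg k)ᶜ, v ((n + (i : ℕ) : ℕ) : ZMod L) = u i}
  let V₂ : ℕ → Set (ZMod L → A) := fun k =>
    {v | ∀ i ∈ seg k, v (((i : ℕ) - window L k : ℤ) : ZMod L) = u i}
  have hinj : ∀ s : ℤ, Function.Injective fun i : Fin L => ((s + (i : ℕ) : ℤ) : ZMod L) := by
    intro s i j hij
    have h1 := (ZMod.intCast_eq_intCast_iff_dvd_sub _ _ _).1 hij
    rw [add_sub_add_left_eq_sub] at h1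
    have h2 := Int.eq_zero_of_abs_lt_dvd h1 (abs_lt.2 ⟨by omega, by omega⟩)
    exact Fin.ext (by omega)
  have hV₁ : ∀ k n, P (V₁ k n) = ∏ i ∈ (seg k)ᶜ, ν {u i} := fun k n => by
    refine (congrArg P ?_).trans (pi_setOf_forall_eq ν (hinj n) (seg k)ᶜ u)
    ext v; simp [V₁]
  have hV₂ : ∀ k, P (V₂ k) = ∏ i ∈ seg k, ν {u i} := fun k => by
    refine (congrArg P ?_).trans (pi_setOf_forall_eq ν (hinj (-window L k)) (seg k) u)
    ext v; simp [V₂, sub_eq_neg_add]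
  let l : Bool → Measure (ZMod L → A) := fun β => bif β then Measure.dirac (fun _ => a₀) else κ
  have hcellE : ∀ k < 2 * L, ∀ β n, m (cell k β n c ∩ E) =
      m (cell k β n c) * ((∏ i ∈ (seg k)ᶜ, ν {u i}) * l β (V₂ k)) := by
    intro k hk β n
    rcases lt_or_ge K n with hn | hn
    · have : cell k β n c = ∅ := by
        refine Set.eq_empty_of_forall_notMem fun x hx => ?_
        have h1 : H x = n := hx.2
        have h2 : H x ≤ K := hit_le
        omega
      simp [this]
    let Vβ : Set (ZMod L → A) := {v | (bif β then (fun _ => a₀) else v) ∈ V₂ k}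
    have hVm : ∀ V : Set (ZMod L → A), MeasurableSet V := fun V => V.toFinite.measurableSet
    have hVβ : κ Vβ = l β (V₂ k) := by
      cases β
      · rfl
      · by_cases h : (fun _ => a₀) ∈ V₂ k
        · simp [Vβ, l, h]
        · simp [Vβ, l, h]
    have hae : m (cell k β n c ∩ E) =
        m (cell k β n c ∩ flow T (past n) ⁻¹' (w ⁻¹' (V₁ k n ×ˢ Vβ))) := by
      refine measure_congr (hgood.mono fun x hx => propext (and_congr_right fun hxc => ?_))
      have hHx : hit T B past K x = n := hxc.2
      have hNx : hit T D (window L) (2 * L - 1) x = k := hxc.1.1.2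
      have hβ : β = true ↔ flow T (window L k) x ∈ B := hxc.1.2
      have ha : (window L k = L ∧ ∀ b : ℤ, -L < b → b < L → flow T b x ∉ D) ∨
          (-L < window L k ∧ window L k < L ∧ flow T (window L k) x ∈ D) := by
        rcases Nat.lt_or_ge k (2 * L - 1) with hk' | hk'
        · refine Or.inr ⟨by simp only [window]; omega, by simp only [window]; omega, ?_⟩
          rw [← hNx] at hk' ⊢
          exact flow_hit_mem hk'
        · refine Or.inl ⟨by simp only [window]; omega, fun b hb1 hb2 => ?_⟩
          have := flow_notMem_of_lt_hit (T := T) (s := D) (b := window L) (K := 2 * L - 1)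
            (x := x) (k := (b + L - 1).toNat) (by omega)
          rwa [show window L (b + L - 1).toNat = b by simp only [window]; omega] at this
      have hcode := fun i : Fin L => code_flow (a₀ := a₀) (w := w) hBD hsep hx ha i.isLt
      simp only [hHx] at hcode
      change (∀ i : Fin L, code T B D L K a₀ w (flow T (i : ℕ) x) = u i) ↔
        (w (flow T (past n) x)).1 ∈ V₁ k n ∧ (w (flow T (past n) x)).2 ∈ Vβ
      simp only [hcode]
      constructor
      · intro h
        refine ⟨fun i hi => ?_, fun i hi => ?_⟩
        · have h1 := h i
          rwa [if_neg (by simpa [seg] using hi)] at h1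
        · have h1 := h i
          rw [if_pos (by simpa [seg] using hi)] at h1
          cases β
          · rwa [if_neg (by simpa using hβ)] at h1
          · rwa [if_pos (by simpa using hβ)] at h1
      · rintro ⟨h1, h2⟩ i
        split_ifs with hi hB'
        · have h3 := h2 i (by simpa [seg] using hi)
          rwa [hβ.2 hB'] at h3
        · have h3 := h2 i (by simpa [seg] using hi)
          rwa [Bool.eq_false_iff.2 fun h => hB' (hβ.1 h)] at h3
        · exact h1 i (by simpa [seg] using hi)
    have hpre : flow T (n : ℕ) ⁻¹' (cell k β n c ∩ flow T (past n) ⁻¹' (w ⁻¹' (V₁ k n ×ˢ Vβ))) =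
        flow T (n : ℕ) ⁻¹' cell k β n c ∩ w ⁻¹' (V₁ k n ×ˢ Vβ) := by
      ext x; simp [flow_flow]
    have h1 := hwC (⟨k, hk⟩, β, ⟨n, by omega⟩, c) (V₁ k n ×ˢ Vβ)
    simp only at h1
    rw [hae, ← measure_flow_preimage hT n ((hcell k β n c).inter (measurable_flow T _
      (hw ((hVm _).prod (hVm _))))), hpre, h1, measure_flow_preimage hT _ (hcell k β n c),
      Measure.prod_prod, hV₁, hVβ]
  have hFE : ∀ k < 2 * L, ∀ β, m ({x | G x = c} ∩ N ⁻¹' {k} ∩ F k β ∩ E) =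
      m ({x | G x = c} ∩ N ⁻¹' {k} ∩ F k β) * ((∏ i ∈ (seg k)ᶜ, ν {u i}) * l β (V₂ k)) := by
    intro k hk β
    refine measure_eq_mul_of_fibers hH fun n => ?_
    rw [Set.inter_right_comm]
    exact hcellE k hk β n
  have hsplit : ∀ k, ∀ X : Set Ω, m X = m (X ∩ F k true) + m (X ∩ F k false) := by
    intro k X
    rw [← measure_inter_add_sdiff X (hF k true)]
    congr 2
    ext x; simp [F]
  change m ({x | G x = c} ∩ E) = _
  refine measure_eq_mul_of_fibers hN fun k => ?_
  rw [Set.inter_right_comm]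
  have hprod : ∏ i, ν {u i} = (∏ i ∈ (seg k)ᶜ, ν {u i}) * ∏ i ∈ seg k, ν {u i} := by
    rw [mul_comm, Finset.prod_mul_prod_compl]
  rcases lt_trichotomy k (2 * L - 1) with hk | hk | hk
  · rw [hsplit k, Set.inter_right_comm, hFE k (by omega), Set.inter_right_comm _ E,
      hFE k (by omega)]
    have hND : N ⁻¹' {k} = flow T (window L k) ⁻¹' D := by
      ext x
      refine ⟨fun hx => ?_, fun hx => hit_eq_of_mem hk.le hx fun j hj hjD => ?_⟩
      · have h1 : N x = k := hx
        rw [← h1] at hk ⊢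
        exact flow_hit_mem hk
      · refine hsep _ hjD (window L k - window L j) (by simp only [window]; omega)
          (by simp only [window]; omega) ?_
        rwa [flow_flow, sub_add_cancel]
    set Z := {x | G x = c} ∩ N ⁻¹' {k}
    have hZ1 : m (Z ∩ F k true) = m Z * t := by
      have := hBt c (window L k) (by simp only [window]; omega) (by simp only [window]; omega)
      rw [← hND] at this
      rw [← this]
      congr 2
      ext x; simp [F]
    have hZ2 : m (Z ∩ F k false) = m Z * (1 - t) := by
      have h1 := hsplit k Z
      have h2 : m Z = m Z * t + m Z * (1 - t) := by
        rw [← mul_add, add_tsub_cancel_of_le ht1.le, mul_one]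
      rw [hZ1] at h1
      exact (ENNReal.add_right_inj (ENNReal.mul_ne_top (measure_ne_top _ _)
        (ht1.trans ENNReal.one_lt_top).ne)).1 (h1.symm.trans h2)
    -- The segment is constant with probability `t` and has law `κ` otherwise: in total, i.i.d.
    rw [hZ1, hZ2, hprod, ← hV₂, hPκ]
    simp only [l, cond_true, cond_false, Measure.add_apply, Measure.smul_apply, smul_eq_mul]
    ring
  · -- no marker nearby: the whole window is filled with independent symbols
    have hseg : seg k = ∅ := by
      refine Finset.eq_empty_of_forall_notMem fun i hi => ?_
      simp only [seg, window, Finset.mem_filter] at hi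
      omega
    have hV : ∀ β, l β (V₂ k) = 1 := by
      have : V₂ k = Set.univ := by ext v; simp [V₂, hseg]
      intro β
      cases β <;> simp [l, this]
    rw [hsplit k, Set.inter_right_comm, hFE k (by omega), Set.inter_right_comm _ E,
      hFE k (by omega), hV, hV, hprod, hseg, Finset.prod_empty, ← add_mul, ← hsplit k]
  · have : N ⁻¹' {k} = ∅ := by
      refine Set.eq_empty_of_forall_notMem fun x hx => ?_
      have h1 : N x = k := hx
      have h2 : N x ≤ 2 * L - 1 := hit_le
      omega
    simp [this]

end Law

/-! ### Existence of building families -/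

/-- Independence and the marginal laws, read off from the probabilities of single values. -/
theorem indep_of_measure_eq_mul_prod {Ω S Q A : Type*} [MeasurableSpace Ω] {m : Measure Ω}
    [IsProbabilityMeasure m] [Countable S] [MeasurableSpace S] [MeasurableSingletonClass S]
    [Fintype Q] [Countable A] [MeasurableSpace A] [MeasurableSingletonClass A]
    {ρ : Measure A} [IsProbabilityMeasure ρ] {G : Ω → S} (hG : Measurable G) {X : Q → Ω → A}
    (hX : ∀ q, Measurable (X q))
    (h : ∀ (c : S) (v : Q → A), m {x | G x = c ∧ ∀ q, X q x = v q} =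
      m {x | G x = c} * ∏ q, ρ {v q}) :
    (∀ q, m.map (X q) = ρ) ∧ iIndepFun X m ∧ IndepFun (fun x q => X q x) G m := by
  have hX' : Measurable fun x q => X q x := measurable_pi_lambda _ hX
  have hprob := Measure.isProbabilityMeasure_map (μ := m) hG.aemeasurable
  have joint : m.map (fun x => (G x, fun q => X q x)) = (m.map G).prod (Measure.pi fun _ => ρ) := by
    refine Measure.ext_of_singleton fun p => ?_
    rw [Measure.map_apply (hG.prodMk hX') (measurableSet_singleton _),
      ← Set.singleton_prod_singleton,
      Measure.prod_prod, Measure.map_apply hG (measurableSet_singleton _), Measure.pi_singleton]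
    refine Eq.trans (congrArg m ?_) (h p.1 p.2)
    ext x; simp [funext_iff, Prod.ext_iff]
  have hpi : m.map (fun x q => X q x) = Measure.pi fun _ => ρ := by
    have := congrArg (Measure.map Prod.snd) joint
    rwa [Measure.map_map measurable_snd (hG.prodMk hX'), Measure.map_snd_prod, measure_univ,
      one_smul] at this
  have hmarg : ∀ q, m.map (X q) = ρ := fun q => by
    rw [← (measurePreserving_eval (fun _ : Q => ρ) q).map_eq, ← hpi,
      Measure.map_map (measurable_pi_apply q) hX']
    rfl
  refine ⟨hmarg, ?_, ?_⟩
  · rw [iIndepFun_iff_map_fun_eq_pi_map fun q => (hX q).aemeasurable, hpi]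
    simp_rw [hmarg]
  · refine IndepFun.symm ?_
    rw [indepFun_iff_map_prod_eq_prod_map_map hG.aemeasurable hX'.aemeasurable, joint, hpi]

/-- The law on `{0, 1, 2}`, which stands for `{-1, 0, 1}`, with mass `s / 2` at both ends. -/
noncomputable def signLaw (s : ℝ) : Measure (Fin 3) :=
  ENNReal.ofReal (s / 2) • Measure.dirac 0 + ENNReal.ofReal (1 - s) • Measure.dirac 1 +
    ENNReal.ofReal (s / 2) • Measure.dirac 2

theorem signLaw_zero (s : ℝ) : signLaw s {0} = ENNReal.ofReal (s / 2) := by simp [signLaw]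
theorem signLaw_one (s : ℝ) : signLaw s {1} = ENNReal.ofReal (1 - s) := by simp [signLaw]
theorem signLaw_two (s : ℝ) : signLaw s {2} = ENNReal.ofReal (s / 2) := by simp [signLaw]

theorem isProbabilityMeasure_signLaw {s : ℝ} (h0 : 0 ≤ s) (h1 : s ≤ 1) :
    IsProbabilityMeasure (signLaw s) := by
  refine ⟨?_⟩
  simp only [signLaw, Measure.add_apply, Measure.smul_apply, measure_univ, smul_eq_mul, mul_one]
  rw [← ENNReal.ofReal_add (by linarith) (by linarith), ← ENNReal.ofReal_add (by linarith)
    (by linarith), show s / 2 + (1 - s) + s / 2 = 1 by ring, ENNReal.ofReal_one]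

theorem two_pow_le_p (k : ℕ) : 2 ^ k ≤ p k := by
  unfold p; split_ifs <;> omega

theorem p_le_two_pow (k : ℕ) : p k ≤ 2 ^ k + 1 := by
  unfold p; split_ifs <;> omega

theorem p_pos (k : ℕ) : 0 < p k := lt_of_lt_of_le (by positivity) (two_pow_le_p k)

/-- The bound needs `2 ≤ k`: it fails for the exceptional value `α 1 = 1 / 2`. -/
theorem α_sq_le {k : ℕ} (hk : 2 ≤ k) : α k ^ 2 ≤ 1 / (2 ^ k * p k) := by
  have hk' : (2 : ℝ) ≤ k := by exact_mod_cast hk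
  have hlog : (1 : ℝ) ≤ Real.logb 2 k := by
    rw [Real.le_logb_iff_rpow_le (by norm_num) (by linarith), Real.rpow_one]
    exact hk'
  have h1 : (1 : ℝ) ≤ k * Real.logb 2 k := by nlinarith
  have hp : (2 : ℝ) ^ k ≤ p k := by exact_mod_cast two_pow_le_p k
  have hp0 : (0 : ℝ) < p k := by exact_mod_cast p_pos k
  rw [α, if_neg (by omega), div_pow, one_pow, mul_pow, Real.sq_sqrt (by linarith)]
  apply one_div_le_one_div_of_le (by positivity)
  calc (2 : ℝ) ^ k * p k ≤ p k * p k := by gcongr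
    _ = p k ^ 2 * 1 := by ring
    _ ≤ p k ^ 2 * (k * Real.logb 2 k) := by gcongr

theorem α_pos {k : ℕ} (hk : 1 ≤ k) : 0 < α k := by
  unfold α
  split_ifs with h
  · norm_num
  · have hk' : (1 : ℝ) < k := by exact_mod_cast (show 1 < k by omega)
    have hlog : 0 < Real.logb 2 k := Real.logb_pos (by norm_num) hk'
    have hp0 : (0 : ℝ) < p k := by exact_mod_cast p_pos k
    positivity

theorem α_sq_lt_one {k : ℕ} (hk : 1 ≤ k) : α k ^ 2 < 1 := by
  rcases hk.eq_or_lt with rfl | hk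
  · norm_num [α]
  · refine (α_sq_le hk).trans_lt ?_
    have h1 : (1 : ℝ) ≤ p k := by exact_mod_cast p_pos k
    have h2 : (1 : ℝ) < 2 ^ k := one_lt_pow₀ (by norm_num) (by omega)
    rw [div_lt_one (by positivity)]
    nlinarith

/-- Recursion in which each term is computed from all earlier ones; `x₀` fills the places of the
terms that are not yet available. -/
def historyRec {X : Type*} (x₀ : X) (Φ : ℕ → (ℕ → X) → X) (k : ℕ) : X :=
  Φ k fun l => if l < k then historyRec x₀ Φ l else x₀
termination_by k

/-- Dependent choice, where `R k f x` only looks at the terms `f l` with `l < k`. -/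
theorem exists_sequence_of_history {X : Type*} (x₀ : X) {R : ℕ → (ℕ → X) → X → Prop}
    (hR : ∀ k f, ∃ x, R k f x) (hcongr : ∀ k f f' x, (∀ l < k, f l = f' l) → R k f x → R k f' x) :
    ∃ f : ℕ → X, ∀ k, R k f (f k) := by
  choose Φ hΦ using hR
  refine ⟨historyRec x₀ Φ, fun k => ?_⟩
  rw [historyRec]
  exact hcongr k _ _ _ (fun l hl => if_pos hl) (hΦ k _)

theorem exists_isBuildingFamily {Ω : Type*} [MeasurableSpace Ω] [StandardBorelSpace Ω]
    {m : Measure Ω} [IsProbabilityMeasure m] {T : Ω ≃ᵐ Ω} (hT : MeasurePreserving T m m)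
    (hap : Aperiodic m T) : ∃ fbar : ℕ → Fin 2 → Ω → ℤ, IsBuildingFamily m T fbar := by
  classical
  let X := {g : Ω → Fin 2 → Fin 3 // Measurable g}
  let lowerLevels : ∀ k : ℕ, (ℕ → X) → Ω →
      (Finset.Ico 1 k × Fin 2 × Fin (2 * d k + p k + 1)) → Fin 3 :=
    fun k f x q => (f q.1).1 (T^[q.2.2] x) q.2.1
  have hpast : ∀ k f, Measurable (lowerLevels k f) := fun k f => measurable_pi_lambda _ fun q =>
    (measurable_pi_apply _).comp ((f q.1).2.comp (T.measurable.iterate _))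
  obtain ⟨F, hF⟩ := exists_sequence_of_history (X := X) ⟨fun _ _ => 0, measurable_const⟩
    (R := fun k f g => 1 ≤ k → ∀ c (v : Fin 2 × Fin (2 * d k + p k + 1) → Fin 3),
      m {x | lowerLevels k f x = c ∧
          ∀ q : Fin 2 × Fin (2 * d k + p k + 1), g.1 (T^[q.2] x) q.1 = v q} =
        m {x | lowerLevels k f x = c} * ∏ q, signLaw (α k ^ 2) {v q})
    (fun k f => by
      rcases Nat.eq_zero_or_pos k with rfl | hk
      · exact ⟨⟨fun _ _ => 0, measurable_const⟩, by simp⟩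
      have := isProbabilityMeasure_signLaw (sq_nonneg (α k)) (α_sq_lt_one hk).le
      obtain ⟨g, hg, hlaw⟩ := exists_iid_window (A := Fin 2 → Fin 3) hT hap (hpast k f)
        (Measure.pi fun _ => signLaw (α k ^ 2)) (a₀ := fun _ => 1) (by
          rw [Measure.pi_singleton]
          refine Finset.prod_ne_zero_iff.2 fun _ _ => ?_
          rw [signLaw_one]
          simpa using α_sq_lt_one hk) (L := 2 * d k + p k + 1) (by omega)
      refine ⟨⟨g, hg⟩, fun _ c v => ?_⟩
      have h1 := hlaw c fun i j => v (j, i)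
      simp only [Measure.pi_singleton] at h1
      rw [Fintype.prod_prod_type_right, ← h1]
      congr 1
      ext x
      simp only [Set.mem_ofPred_eq, flow_natCast, funext_iff (α := Fin 2), Prod.forall]
      exact and_congr_right fun _ => forall_comm)
    (fun k f f' g hff' h hk c v => by
      have : lowerLevels k f = lowerLevels k f' := by
        ext x q
        simp only [lowerLevels]
        rw [hff' _ (Finset.mem_Ico.1 q.1.2).2]
      rw [← this]
      exact h hk c v)
  let φ : Fin 3 → ℤ := fun a => a - 1
  have hφ : Measurable φ := measurable_of_countable _
  have key := fun k (hk : 1 ≤ k) =>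
    have := isProbabilityMeasure_signLaw (sq_nonneg (α k)) (α_sq_lt_one hk).le
    indep_of_measure_eq_mul_prod (ρ := signLaw (α k ^ 2)) (hpast k F)
      (X := fun (q : Fin 2 × Fin (2 * d k + p k + 1)) x => (F k).1 (T^[q.2] x) q.1)
      (fun q => (measurable_pi_apply _).comp ((F k).2.comp (T.measurable.iterate _))) (hF k hk)
  have hmeas : ∀ k i, Measurable fun x => (F k).1 x i := fun k i =>
    (measurable_pi_apply _).comp (F k).2
  have hval : ∀ k, 1 ≤ k → ∀ i a, m {x | (F k).1 x i = a} = signLaw (α k ^ 2) {a} := by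
    intro k hk i a
    have h : m.map (fun x => (F k).1 x i) = _ := (key k hk).1 (i, 0)
    rw [← h, Measure.map_apply (hmeas k i) (measurableSet_singleton _)]
    rfl
  refine ⟨fun k i x => φ ((F k).1 x i), ?_, ?_, ?_, ?_, ?_, ?_, ?_⟩
  · exact fun k _ i => hφ.comp (hmeas k i)
  · intro k _ i x
    generalize (F k).1 x i = a
    fin_cases a <;> simp [φ]
  · intro k hk i
    rw [← signLaw_two, ← hval k hk i]
    congr 1; ext x
    simp only [Set.mem_ofPred_eq]
    generalize (F k).1 x i = a
    fin_cases a <;> simp [φ]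
  · intro k hk i
    rw [← signLaw_zero, ← hval k hk i]
    congr 1; ext x
    simp only [Set.mem_ofPred_eq]
    generalize (F k).1 x i = a
    fin_cases a <;> simp [φ]
  · exact fun k hk => (key k hk).2.1.comp (fun _ => φ) fun _ => hφ
  · intro k hk q r
    have h1 : ∀ q : Fin 2 × Fin (2 * d k + p k + 1),
        Measurable fun x => (F k).1 (T^[q.2] x) q.1 := fun q =>
      (hmeas k q.1).comp (T.measurable.iterate _)
    have h2 : IdentDistrib (fun x => (F k).1 (T^[q.2] x) q.1) (fun x => (F k).1 (T^[r.2] x) r.1)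
        m m := ⟨(h1 q).aemeasurable, (h1 r).aemeasurable,
      ((key k hk).1 q).trans ((key k hk).1 r).symm⟩
    exact h2.comp hφ
  · intro k hk
    exact (key k hk).2.2.comp (φ := fun v q => φ (v q)) (ψ := fun v q => φ (v q))
      (measurable_of_countable _) (measurable_of_countable _)

/-! ### Levels of a building family -/

theorem one_sub_sum_le_prod {ι : Type*} (s : Finset ι) {f : ι → ℝ} (h0 : ∀ i ∈ s, 0 ≤ f i)
    (h1 : ∀ i ∈ s, f i ≤ 1) : 1 - ∑ i ∈ s, (1 - f i) ≤ ∏ i ∈ s, f i := by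
  classical
  induction s using Finset.induction_on with
  | empty => simp
  | insert a s ha ih =>
    rw [Finset.sum_insert ha, Finset.prod_insert ha]
    have h2 := ih (fun i hi => h0 i (Finset.mem_insert_of_mem hi))
      fun i hi => h1 i (Finset.mem_insert_of_mem hi)
    have h3 := h0 a (Finset.mem_insert_self a s)
    have h4 := h1 a (Finset.mem_insert_self a s)
    have h5 : 0 ≤ ∑ i ∈ s, (1 - f i) := Finset.sum_nonneg fun i hi =>
      sub_nonneg.2 (h1 i (Finset.mem_insert_of_mem hi))
    nlinarith

theorem d_mono : Monotone d := fun k l h =>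
  Nat.pow_le_pow_right (by norm_num) (Nat.pow_le_pow_left h 2)

theorem p_mono : Monotone p := monotone_nat_of_le_succ fun k => by
  have h1 := p_le_two_pow k
  have h2 := two_pow_le_p (k + 1)
  have h3 : 1 ≤ 2 ^ k := Nat.one_le_two_pow
  omega

theorem p_le_d {k : ℕ} (hk : 2 ≤ k) : p k ≤ d k := by
  have h1 := p_le_two_pow k
  have h2 : 2 ^ (k + 1) ≤ 2 ^ (k ^ 2) := Nat.pow_le_pow_right (by norm_num) (by nlinarith)
  have h3 : 1 ≤ 2 ^ k := Nat.one_le_two_pow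
  unfold d
  omega

theorem le_d (k : ℕ) : k ≤ d k := by
  have h1 : k < 2 ^ k := Nat.lt_two_pow_self
  have h2 : 2 ^ k ≤ 2 ^ (k ^ 2) :=
    Nat.pow_le_pow_right (by norm_num) (Nat.le_self_pow (by norm_num) k)
  unfold d
  omega

section Family

variable {Ω : Type*} [MeasurableSpace Ω] {m : Measure Ω} {T : Ω ≃ᵐ Ω}
  {fbar : ℕ → Fin 2 → Ω → ℤ}

namespace IsBuildingFamily

theorem measurable_iterate (hb : IsBuildingFamily m T fbar) {k : ℕ} (hk : 1 ≤ k) (i : Fin 2)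
    (s : ℕ) : Measurable fun x => fbar k i (T^[s] x) :=
  (hb.measurable k hk i).comp (T.measurable.iterate s)

theorem measure_iterate_eq (hb : IsBuildingFamily m T fbar) (hT : MeasurePreserving T m m) {k : ℕ}
    (hk : 1 ≤ k) (i : Fin 2) (s : ℕ) (c : ℤ) :
    m {x | fbar k i (T^[s] x) = c} = m {x | fbar k i x = c} :=
  (hT.iterate s).measure_preimage (s := {x | fbar k i x = c})
    (hb.measurable k hk i (measurableSet_singleton c)).nullMeasurableSet

theorem measure_ne_zero_le (hb : IsBuildingFamily m T fbar) {k : ℕ} (hk : 1 ≤ k) (i : Fin 2) :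
    m {x | fbar k i x ≠ 0} ≤ ENNReal.ofReal (α k ^ 2) := by
  calc m {x | fbar k i x ≠ 0} ≤ m ({x | fbar k i x = 1} ∪ {x | fbar k i x = -1}) := by
        refine measure_mono fun x (hx : fbar k i x ≠ 0) => ?_
        rcases hb.values k hk i x with h | h | h
        · exact Or.inr h
        · exact absurd h hx
        · exact Or.inl h
    _ ≤ ENNReal.ofReal (α k ^ 2 / 2) + ENNReal.ofReal (α k ^ 2 / 2) := by
        exact (measure_union_le _ _).trans_eq
          (by rw [hb.prob_one k hk i, hb.prob_neg_one k hk i])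
    _ = _ := by
        rw [← ENNReal.ofReal_add (by positivity) (by positivity), add_halves]

theorem measure_exists_ne_zero_le (hb : IsBuildingFamily m T fbar) (hT : MeasurePreserving T m m)
    {k : ℕ} (hk : 1 ≤ k) (i : Fin 2) (s : Finset ℕ) :
    m {x | ∃ j ∈ s, fbar k i (T^[j] x) ≠ 0} ≤ s.card * ENNReal.ofReal (α k ^ 2) := by
  have : {x | ∃ j ∈ s, fbar k i (T^[j] x) ≠ 0} = ⋃ j ∈ s, {x | fbar k i (T^[j] x) ≠ 0} := by
    ext x; simp
  rw [this, ← nsmul_eq_mul]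
  refine (measure_biUnion_finset_le _ _).trans (Finset.sum_le_card_nsmul _ _ _ fun j _ => ?_)
  refine le_trans (le_of_eq ?_) (hb.measure_ne_zero_le hk i)
  exact (hT.iterate j).measure_preimage (s := {x | fbar k i x ≠ 0})
    (hb.measurable k hk i (measurableSet_singleton 0)).compl.nullMeasurableSet

theorem measure_zero_pos [IsProbabilityMeasure m] (hb : IsBuildingFamily m T fbar) {k : ℕ}
    (hk : 1 ≤ k) (i : Fin 2) : 0 < m {x | fbar k i x = 0} := by
  refine pos_iff_ne_zero.2 fun h => ?_
  have h1 := prob_compl_eq_one_sub (μ := m) (hb.measurable k hk i (measurableSet_singleton 0))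
  rw [show m (fbar k i ⁻¹' {0}) = 0 from h, tsub_zero] at h1
  have h2 := hb.measure_ne_zero_le hk i
  rw [show m {x | fbar k i x ≠ 0} = 1 from h1, ENNReal.one_le_ofReal] at h2
  exact absurd h2 (not_le.2 (α_sq_lt_one hk))

end IsBuildingFamily

/-- The times at which `level T fbar k i` at the points `x, …, T^[n] x` evaluates `fbar k i`. -/
def levelSupport (k n : ℕ) : Finset ℕ :=
  Finset.range (p k + n) ∪ (Finset.range (p k + n)).image (d k + ·)

theorem card_levelSupport_le (k n : ℕ) : (levelSupport k n).card ≤ 2 * (p k + n) := by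
  refine (Finset.card_union_le _ _).trans ?_
  have := Finset.card_image_le (s := Finset.range (p k + n)) (f := (d k + ·))
  rw [Finset.card_range] at *
  omega

theorem mem_levelSupport {k n s : ℕ} :
    s ∈ levelSupport k n ↔ s < p k + n ∨ ∃ t < p k + n, d k + t = s := by
  simp [levelSupport]

theorem level_iterate (T : Ω ≃ᵐ Ω) (fbar : ℕ → Fin 2 → Ω → ℤ) (k : ℕ) (i : Fin 2) (j : ℕ) (x : Ω) :
    level T fbar k i (T^[j] x) =
      ∑ s ∈ Finset.range (p k), (fbar k i (T^[s + j] x) - fbar k i (T^[d k + (s + j)] x)) := by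
  simp only [level, ← Function.iterate_add_apply, add_assoc]

theorem level_eq_zero {k n : ℕ} {i : Fin 2} {x : Ω}
    (h : ∀ s ∈ levelSupport k n, fbar k i (T^[s] x) = 0) {j : ℕ} (hj : j ≤ n) :
    level T fbar k i (T^[j] x) = 0 := by
  rw [level_iterate]
  refine Finset.sum_eq_zero fun s hs => ?_
  have hs' := Finset.mem_range.1 hs
  rw [h _ (mem_levelSupport.2 (Or.inl (by omega))),
    h _ (mem_levelSupport.2 (Or.inr ⟨s + j, by omega, rfl⟩)), sub_zero]

theorem card_levelSupport_mul_α_sq_le {k : ℕ} (hk : 2 ≤ k) (n : ℕ) :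
    (levelSupport k n).card * α k ^ 2 ≤ 2 * (n + 1) * (1 / 2) ^ k := by
  have hp : (1 : ℝ) ≤ p k := by exact_mod_cast p_pos k
  have h1 : ((levelSupport k n).card : ℝ) ≤ 2 * (p k + n) := by
    exact_mod_cast card_levelSupport_le k n
  calc (levelSupport k n).card * α k ^ 2 ≤ 2 * (p k + n) * (1 / (2 ^ k * p k)) := by
        gcongr
        exact α_sq_le hk
    _ ≤ 2 * ((n + 1) * p k) * (1 / (2 ^ k * p k)) := by
        gcongr
        nlinarith [(Nat.cast_nonneg n : (0 : ℝ) ≤ n)]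
    _ = 2 * (n + 1) * (1 / 2) ^ k := by
        rw [one_div_pow]; field_simp

theorem IsBuildingFamily.measure_levelSupport_le (hb : IsBuildingFamily m T fbar)
    (hT : MeasurePreserving T m m) {k : ℕ} (hk : 2 ≤ k) (i : Fin 2) (n : ℕ) :
    m {x | ∃ s ∈ levelSupport k n, fbar k i (T^[s] x) ≠ 0} ≤
      ENNReal.ofReal (2 * (n + 1) * (1 / 2) ^ k) := by
  refine (hb.measure_exists_ne_zero_le hT (by omega) i _).trans ?_
  rw [← ENNReal.ofReal_natCast, ← ENNReal.ofReal_mul (by positivity)]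
  exact ENNReal.ofReal_le_ofReal (card_levelSupport_mul_α_sq_le hk n)

/-- The Borel–Cantelli lemma: level `k` is nonzero with probability at most `2 / 2 ^ k`. -/
theorem IsBuildingFamily.ae_finite_level_ne_zero (hb : IsBuildingFamily m T fbar)
    (hT : MeasurePreserving T m m) :
    ∀ᵐ x ∂m, ∀ i : Fin 2, {k : ℕ | 1 ≤ k ∧ level T fbar k i x ≠ 0}.Finite := by
  refine ae_all_iff.2 fun i => ?_
  have hsum : ∑' k, m {x | level T fbar (k + 2) i x ≠ 0} ≠ ⊤ := by
    refine ne_top_of_le_ne_top ?_ (ENNReal.tsum_le_tsum fun k =>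
      le_trans (measure_mono ?_) (hb.measure_levelSupport_le hT (k := k + 2) (by omega) i 0))
    · have hs : Summable fun k : ℕ => 2 * ((0 : ℕ) + 1) * (1 / 2 : ℝ) ^ (k + 2) :=
        ((summable_nat_add_iff 2).2 summable_geometric_two).mul_left _
      exact hs.tsum_ofReal_ne_top
    · intro x hx
      by_contra hcon
      refine hx (level_eq_zero (n := 0) (fun s hs => ?_) le_rfl)
      by_contra hne
      exact hcon ⟨s, hs, hne⟩
  filter_upwards [ae_finite_setOfPred_mem hsum] with x hx
  refine ((hx.image (· + 2)).union (Set.finite_singleton 1)).subset fun k hk => ?_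
  rcases hk.1.eq_or_lt with h | h
  · exact Or.inr h.symm
  · exact Or.inl ⟨k - 2, by simpa [Nat.sub_add_cancel h] using hk.2, by simp; omega⟩

end Family

/-! ### Prescribing the patterns of all large levels -/

section Patterns

variable {Ω : Type*} [MeasurableSpace Ω] {m : Measure Ω} {T : Ω ≃ᵐ Ω}
  {fbar : ℕ → Fin 2 → Ω → ℤ}

/-- The event that `fbar l i ∘ T ^ j` takes the value `w l j` for all times `j ∈ s l`. -/
def pattern (T : Ω ≃ᵐ Ω) (fbar : ℕ → Fin 2 → Ω → ℤ) (i : Fin 2) (s : ℕ → Finset ℕ)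
    (w : ℕ → ℕ → ℤ) (l : ℕ) : Set Ω :=
  {x | ∀ j ∈ s l, fbar l i (T^[j] x) = w l j}

variable {i : Fin 2} {s : ℕ → Finset ℕ} {w : ℕ → ℕ → ℤ}

namespace IsBuildingFamily

theorem measurableSet_pattern (hb : IsBuildingFamily m T fbar) {l : ℕ} (hl : 1 ≤ l) :
    MeasurableSet (pattern T fbar i s w l) := by
  have : pattern T fbar i s w l = ⋂ j ∈ s l, (fun x => fbar l i (T^[j] x)) ⁻¹' {w l j} := by
    ext x; simp [pattern]
  rw [this]
  exact (s l).measurableSet_biInter fun j _ =>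
    hb.measurable_iterate hl i j (measurableSet_singleton _)

/-- Patterns of different levels are independent: the times used by a lower level lie in the range
for which the hypothesis on the next level asserts independence. -/
theorem measure_iInter_pattern [IsProbabilityMeasure m] (hb : IsBuildingFamily m T fbar)
    (hs : ∀ l, ∀ j ∈ s l, j < 2 * d l + p l + 1) {a : ℕ} (ha : 1 ≤ a) (n : ℕ) :
    m (⋂ l ∈ Finset.Ico a (a + n), pattern T fbar i s w l) =
      ∏ l ∈ Finset.Ico a (a + n), m (pattern T fbar i s w l) := by
  induction n with
  | zero => simp
  | succ n ih =>
    rw [← add_assoc, Finset.prod_Ico_succ_top (by omega), ← ih, mul_comm,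
      ← Finset.insert_Ico_right_eq_Ico_add_one (by omega), Finset.set_biInter_insert]
    set K := a + n
    have hmono : ∀ l < K, 2 * d l + p l + 1 ≤ 2 * d K + p K + 1 := fun l hl => by
      have h1 := d_mono hl.le
      have h2 := p_mono hl.le
      omega
    let U : Set (Fin 2 × Fin (2 * d K + p K + 1) → ℤ) :=
      {v | ∀ q, q.1 = i → (q.2 : ℕ) ∈ s K → v q = w K q.2}
    let V : Set (Finset.Ico 1 K × Fin 2 × Fin (2 * d K + p K + 1) → ℤ) :=
      {v | ∀ q, a ≤ q.1 → q.2.1 = i → (q.2.2 : ℕ) ∈ s q.1 → v q = w q.1 q.2.2}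
    have h1 : pattern T fbar i s w K =
        (fun (x : Ω) (q : Fin 2 × Fin (2 * d K + p K + 1)) => fbar K q.1 (T^[q.2] x)) ⁻¹' U := by
      ext x
      constructor
      · rintro h ⟨i', q⟩ rfl hq
        exact h _ hq
      · exact fun h j hj => h (i, ⟨j, hs K j hj⟩) rfl hj
    have h2 : (⋂ l ∈ Finset.Ico a K, pattern T fbar i s w l) =
        (fun (x : Ω) (q : Finset.Ico 1 K × Fin 2 × Fin (2 * d K + p K + 1)) =>
          fbar q.1 q.2.1 (T^[q.2.2] x)) ⁻¹' V := by
      ext x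
      simp only [Set.mem_iInter]
      constructor
      · rintro h ⟨⟨l, hl⟩, i', q⟩ hal rfl hq
        exact h l (Finset.mem_Ico.2 ⟨hal, (Finset.mem_Ico.1 hl).2⟩) _ hq
      · intro h l hl j hj
        have hl' := Finset.mem_Ico.1 hl
        exact h (⟨l, Finset.mem_Ico.2 ⟨by omega, hl'.2⟩⟩, i,
          ⟨j, (hs l j hj).trans_le (hmono l hl'.2)⟩) hl'.1 rfl hj
    rw [h1, h2]
    exact (hb.indep_level K (by omega)).measure_inter_preimage_eq_mul _ _
      U.to_countable.measurableSet V.to_countable.measurableSet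

theorem measure_pattern_pos [IsProbabilityMeasure m] (hb : IsBuildingFamily m T fbar)
    (hT : MeasurePreserving T m m) {l : ℕ} (hl : 1 ≤ l) (hs : ∀ j ∈ s l, j < 2 * d l + p l + 1)
    (hw : ∀ j, w l j = 0 ∨ w l j = 1) : 0 < m (pattern T fbar i s w l) := by
  have hinj : Function.Injective fun j : Fin (2 * d l + p l + 1) => (i, j) :=
    fun _ _ h => (Prod.ext_iff.1 h).2
  have h1 := ((hb.indep_time l hl).precomp hinj).measure_inter_preimage_eq_mul Finset.univ
    (sets := fun j => {w l j}) fun j _ => measurableSet_singleton _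
  refine lt_of_lt_of_le ?_ (measure_mono
    (s := ⋂ j ∈ (Finset.univ : Finset (Fin (2 * d l + p l + 1))),
      (fun x => fbar l i (T^[j] x)) ⁻¹' {w l j}) ?_)
  · refine lt_of_lt_of_eq (pos_iff_ne_zero.2 (Finset.prod_ne_zero_iff.2 fun j _ => ?_)) h1.symm
    refine ne_of_gt (lt_of_lt_of_eq ?_ (hb.measure_iterate_eq hT hl i j (w l j)).symm)
    rcases hw j with h | h <;> rw [h]
    · exact hb.measure_zero_pos hl i
    · rw [hb.prob_one l hl i, ENNReal.ofReal_pos]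
      have := α_pos hl
      positivity
  · intro x hx j hj
    simp only [Set.mem_iInter] at hx
    exact hx ⟨j, hs j hj⟩ (Finset.mem_univ _)

/-- With positive probability, level `b` shows a prescribed pattern and all other levels from
`n + 3` on vanish at the points `x, …, T ^ n x`. The levels other than `b` fail to do so with
probabilities that sum to at most `1 / 2`, which is what the bound `n + 3` is for. -/
theorem measure_iInter_pattern_pos [IsProbabilityMeasure m] (hb : IsBuildingFamily m T fbar)
    (hT : MeasurePreserving T m m) (hs : ∀ l, ∀ j ∈ s l, j < 2 * d l + p l + 1) {n b : ℕ}
    (hw : ∀ j, w b j = 0 ∨ w b j = 1) (hb3 : n + 3 ≤ b)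
    (hother : ∀ l, n + 3 ≤ l → l ≠ b → s l = levelSupport l n ∧ w l = 0) :
    0 < m (⋂ l ∈ Set.Ici (n + 3), pattern T fbar i s w l) := by
  set E : ℕ → Set Ω := pattern T fbar i s w
  have hEm : ∀ l, n + 3 ≤ l → MeasurableSet (E l) := fun l hl =>
    hb.measurableSet_pattern (by omega)
  have hEb : 0 < m.real (E b) := ENNReal.toReal_pos
    (hb.measure_pattern_pos hT (by omega) (hs b) hw).ne' (measure_ne_top _ _)
  have hsmall : ∀ l, n + 3 ≤ l → l ≠ b → 1 - m.real (E l) ≤ 2 * (n + 1) * (1 / 2) ^ l := by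
    intro l hl hlb
    rw [← probReal_compl_eq_one_sub (hEm l hl)]
    refine ENNReal.toReal_le_of_le_ofReal (by positivity) ?_
    refine le_trans (measure_mono fun x hx => ?_) (hb.measure_levelSupport_le hT (by omega) i n)
    obtain ⟨h1, h2⟩ := hother l hl hlb
    by_contra hcon
    refine hx fun j hj => ?_
    rw [h1] at hj
    by_contra hne
    exact hcon ⟨j, hj, by simpa [h2] using hne⟩
  have hfin : ∀ N, b < n + 3 + N → m.real (E b) / 2 ≤
      m.real (⋂ l ∈ Finset.Ico (n + 3) (n + 3 + N), E l) := by
    intro N hN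
    rw [measureReal_def, measureReal_def,
      hb.measure_iInter_pattern hs (show 1 ≤ n + 3 by omega), ENNReal.toReal_prod,
      ← Finset.mul_prod_erase _ _ (Finset.mem_Ico.2 ⟨hb3, hN⟩), div_eq_mul_inv]
    refine mul_le_mul_of_nonneg_left ?_ ENNReal.toReal_nonneg
    refine le_trans ?_ (one_sub_sum_le_prod _ (fun l _ => ENNReal.toReal_nonneg)
      fun l _ => measureReal_le_one)
    have h1 : ∑ l ∈ (Finset.Ico (n + 3) (n + 3 + N)).erase b, (1 - m.real (E l)) ≤
        ∑ l ∈ Finset.Ico (n + 3) (n + 3 + N), 2 * (n + 1) * (1 / 2 : ℝ) ^ l := by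
      refine (Finset.sum_le_sum fun l hl => ?_).trans (Finset.sum_le_sum_of_subset_of_nonneg
        (Finset.erase_subset b _) fun _ _ _ => by positivity)
      obtain ⟨h1, h2⟩ := Finset.mem_erase.1 hl
      exact hsmall l (Finset.mem_Ico.1 h2).1 h1
    have h2 : ∑ l ∈ Finset.Ico (n + 3) (n + 3 + N), (1 / 2 : ℝ) ^ l ≤
        (1 / 2) ^ (n + 3) / (1 - 1 / 2) := geom_sum_Ico_le_of_lt_one (by norm_num) (by norm_num)
    have h3 : (n + 1 : ℝ) * (1 / 2) ^ n ≤ 1 := by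
      rw [one_div_pow, mul_one_div, div_le_one (by positivity)]
      exact_mod_cast Nat.lt_two_pow_self (n := n)
    rw [← Finset.mul_sum] at h1
    have h4 : 2 * (n + 1 : ℝ) * ∑ l ∈ Finset.Ico (n + 3) (n + 3 + N), (1 / 2 : ℝ) ^ l ≤
        2 * (n + 1) * ((1 / 2) ^ (n + 3) / (1 - 1 / 2)) := by gcongr
    have h5 : 2 * (n + 1 : ℝ) * ((1 / 2) ^ (n + 3) / (1 - 1 / 2)) =
        (n + 1 : ℝ) * (1 / 2) ^ n / 2 := by rw [pow_add]; ring
    change _ ≤ 1 - ∑ l ∈ (Finset.Ico (n + 3) (n + 3 + N)).erase b, (1 - m.real (E l))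
    linarith
  have hlim : Filter.Tendsto (fun N => m (⋂ l ∈ Finset.Ico (n + 3) (n + 3 + N), E l)) Filter.atTop
      (nhds (m (⋂ N, ⋂ l ∈ Finset.Ico (n + 3) (n + 3 + N), E l))) := by
    refine tendsto_measure_iInter_atTop (fun N => ?_) (fun N N' h => ?_) ⟨0, measure_ne_top _ _⟩
    · exact (Finset.measurableSet_biInter _ fun l hl =>
        hEm l (Finset.mem_Ico.1 hl).1).nullMeasurableSet
    · exact Set.biInter_subset_biInter_left (Finset.Ico_subset_Ico_right (by omega))
  have hinter : (⋂ l ∈ Set.Ici (n + 3), E l) =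
      ⋂ N, ⋂ l ∈ Finset.Ico (n + 3) (n + 3 + N), E l := by
    ext x
    simp only [Set.mem_iInter, Set.mem_Ici, Finset.mem_Ico]
    exact ⟨fun h N l hl => h l hl.1, fun h l hl => h (l + 1) l ⟨hl, by omega⟩⟩
  rw [hinter]
  refine lt_of_lt_of_le (ENNReal.ofReal_pos.2 (half_pos hEb)) (ge_of_tendsto hlim ?_)
  filter_upwards [Filter.eventually_ge_atTop (b + 1)] with N hN
  exact ENNReal.ofReal_le_of_le_toReal (hfin N (by omega))

end IsBuildingFamily

/-- If level `k` is `1` on the times from `n` to `p k - 1` and `0` on all others, then each of the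
sums at `x, …, T ^ (n - 1) x` contains all `p k - n` ones. -/
theorem le_level_iterate {k n : ℕ} (hk : p k ≤ d k) {i : Fin 2} {x : Ω}
    (h : ∀ s < 2 * d k + p k + 1, fbar k i (T^[s] x) = if n ≤ s ∧ s < p k then 1 else 0)
    (hnd : n ≤ d k) {j : ℕ} (hj : j < n) :
    (p k : ℤ) - n ≤ level T fbar k i (T^[j] x) := by
  rw [level_iterate]
  have h1 : ∀ s ∈ Finset.range (p k), fbar k i (T^[s + j] x) - fbar k i (T^[d k + (s + j)] x) =
      if n ≤ s + j ∧ s + j < p k then 1 else 0 := by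
    intro s hs
    have hs' := Finset.mem_range.1 hs
    rw [h _ (by omega), h _ (by omega), if_neg (c := n ≤ d k + (s + j) ∧ _) (by omega), sub_zero]
  rw [Finset.sum_congr rfl h1, Finset.sum_boole]
  have h2 : Finset.Ico (n - j) (p k - j) ⊆
      (Finset.range (p k)).filter fun s => n ≤ s + j ∧ s + j < p k := by
    intro s hs
    have hs' := Finset.mem_Ico.1 hs
    exact Finset.mem_filter.2 ⟨Finset.mem_range.2 (by omega), by omega, by omega⟩
  have h3 := Finset.card_le_card h2
  rw [Nat.card_Ico] at h3
  omega

theorem IsBuildingFamily.neg_two_mul_p_le_level (hb : IsBuildingFamily m T fbar) {k : ℕ}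
    (hk : 1 ≤ k) (i : Fin 2) (x : Ω) : -(2 * p k : ℤ) ≤ level T fbar k i x := by
  have h1 : ∀ s ∈ Finset.range (p k), (-2 : ℤ) ≤
      fbar k i (T^[s] x) - fbar k i (T^[d k + s] x) := by
    intro s _
    have h2 := hb.values k hk i (T^[s] x)
    have h3 := hb.values k hk i (T^[d k + s] x)
    omega
  have h2 := Finset.card_nsmul_le_sum _ _ _ h1
  rw [Finset.card_range, nsmul_eq_mul] at h2
  unfold level
  linarith

/-- With positive probability a coordinate of `f` is positive at `n` consecutive points of the
orbit. The first few levels, whose windows may be too short for independence over `n` steps, are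
bounded by `R`; a single level `b` contributes more than `R`, and all the remaining ones vanish. -/
theorem IsBuildingFamily.exists_one_le_coord [IsProbabilityMeasure m]
    (hb : IsBuildingFamily m T fbar) (hT : MeasurePreserving T m m) (i : Fin 2) (n : ℕ) :
    ∃ E : Set Ω, MeasurableSet E ∧ 0 < m E ∧ ∀ x ∈ E, ∀ j < n, 1 ≤ coord T fbar i (T^[j] x) := by
  set R := ∑ l ∈ Finset.range (n + 3), 2 * p l with hR
  set b := n + 3 + R with hbdef
  have hpb : n + R < p b := by
    have h1 : b < 2 ^ b := Nat.lt_two_pow_self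
    have h2 := two_pow_le_p b
    omega
  have hdb : p b ≤ d b := p_le_d (by omega)
  let s : ℕ → Finset ℕ := fun l =>
    if l = b then Finset.range (2 * d b + p b + 1) else if n + 3 ≤ l then levelSupport l n else ∅
  let w : ℕ → ℕ → ℤ := fun l j => if l = b ∧ n ≤ j ∧ j < p b then 1 else 0
  have hs : ∀ l, ∀ j ∈ s l, j < 2 * d l + p l + 1 := by
    intro l j hj
    simp only [s] at hj
    split_ifs at hj with h1 h2
    · subst h1; exact Finset.mem_range.1 hj
    · have := le_d l
      rcases mem_levelSupport.1 hj with h | ⟨t, ht, rfl⟩ <;> omega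
    · simp at hj
  have hother : ∀ l, n + 3 ≤ l → l ≠ b → s l = levelSupport l n ∧ w l = 0 := fun l hl hlb =>
    ⟨by simp [s, hlb, hl], by ext j; simp [w, hlb]⟩
  refine ⟨⋂ l ∈ Set.Ici (n + 3), pattern T fbar i s w l, ?_,
    hb.measure_iInter_pattern_pos hT hs (b := b) (fun j => ?_) (by omega) hother, ?_⟩
  · exact MeasurableSet.biInter (Set.to_countable _) fun l hl =>
      hb.measurableSet_pattern (le_trans (by omega) (Set.mem_Ici.1 hl))
  · simp only [w]; split_ifs <;> simp
  intro x hx j hj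
  have hx' : ∀ l, n + 3 ≤ l → ∀ t ∈ s l, fbar l i (T^[t] x) = w l t := by
    simp only [Set.mem_iInter, Set.mem_Ici] at hx
    exact hx
  have hzero : ∀ l, n + 3 ≤ l → l ≠ b → level T fbar l i (T^[j] x) = 0 := by
    intro l hl hlb
    obtain ⟨h1, h2⟩ := hother l hl hlb
    refine level_eq_zero (n := n) (fun t ht => ?_) hj.le
    rw [hx' l hl t (h1 ▸ ht), h2, Pi.zero_apply]
  have hbig : (p b : ℤ) - n ≤ level T fbar b i (T^[j] x) := by
    refine le_level_iterate hdb (fun t ht => ?_) (by omega) hj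
    rw [hx' b (by omega) t (by simpa [s] using ht)]
    simp [w]
  have hsum : coord T fbar i (T^[j] x) =
      ∑ k ∈ Finset.range b, level T fbar (k + 1) i (T^[j] x) := by
    refine tsum_eq_sum fun k hk => ?_
    rw [Finset.mem_range, not_lt] at hk
    exact hzero _ (by omega) (by omega)
  have hle : ∀ k ∈ Finset.range b, (if k + 1 = b then (p b : ℤ) - n else 0) -
      (if k + 1 < n + 3 then (2 * p (k + 1) : ℤ) else 0) ≤ level T fbar (k + 1) i (T^[j] x) := by
    intro k _
    have h1 := hb.neg_two_mul_p_le_level (k := k + 1) (by omega) i (T^[j] x)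
    split_ifs with h2 h3 h3
    · omega
    · rw [h2]; linarith
    · linarith
    · rw [hzero _ (by omega) h2]; simp
  rw [hsum]
  refine le_trans ?_ (Finset.sum_le_sum hle)
  have h1 : ∑ k ∈ Finset.range b, (if k + 1 = b then (p b : ℤ) - n else 0) = p b - n := by
    rw [Finset.sum_eq_single (b - 1)]
    · rw [if_pos (by omega)]
    · intro k _ hk
      rw [if_neg (by omega)]
    · intro h
      exact absurd (Finset.mem_range.2 (by omega)) h
  have h2 : ∑ k ∈ Finset.range b, (if k + 1 < n + 3 then (2 * p (k + 1) : ℤ) else 0) ≤ R := by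
    rw [← Finset.sum_filter, hR, Nat.cast_sum, Finset.sum_range_succ' _ (n + 2)]
    refine le_trans (Finset.sum_le_sum_of_subset_of_nonneg (t := Finset.range (n + 2)) ?_ ?_) ?_
    · intro k hk
      have := (Finset.mem_filter.1 hk).2
      exact Finset.mem_range.2 (by omega)
    · intros; positivity
    · push_cast
      linarith [(Nat.cast_nonneg (p 0) : (0 : ℤ) ≤ p 0)]
  rw [Finset.sum_sub_distrib, h1]
  omega

end Patterns

/-! ### The cocycle -/

section Cocycle

variable {Ω : Type*} [MeasurableSpace Ω] {T : Ω ≃ᵐ Ω} {f : Ω → ℤ × ℤ}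

theorem S_natCast (n : ℕ) (x : Ω) : S T f n x = ∑ k ∈ Finset.range n, f (T^[k] x) := rfl

theorem S_natCast_succ (n : ℕ) (x : Ω) :
    S T f ((n : ℤ) + 1) x = S T f n x + f (T^[n] x) :=
  Finset.sum_range_succ _ _

/-- The cocycle identity, for a base point moved forward by `N` and steps back by at most `N`. -/
theorem S_flow_natCast (N : ℕ) (x : Ω) {j : ℤ} (hj : -(N : ℤ) ≤ j) :
    S T f j (flow T N x) = S T f (j + N) x - S T f N x := by
  induction j with
  | zero => simp [S_natCast, show S T f 0 (flow T N x) = 0 from rfl]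
  | succ j ih =>
    rw [S_natCast_succ, ih (by omega), add_right_comm (j : ℤ) 1, ← Nat.cast_add, S_natCast_succ,
      flow_natCast, ← Function.iterate_add_apply]
    abel
  | pred j ih =>
    obtain ⟨k, rfl⟩ : ∃ k, N = k + (j + 1) := ⟨N - (j + 1), by omega⟩
    have h1 : S T f (-(j : ℤ) - 1) (flow T (k + (j + 1) : ℕ) x) =
        S T f (-(j : ℤ)) (flow T (k + (j + 1) : ℕ) x) - f (T^[k] x) := by
      have h2 : f (T.symm^[j + 1] (flow T (k + (j + 1) : ℕ) x)) = f (T^[k] x) := by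
        rw [← flow_neg_natCast, flow_flow, ← flow_natCast]
        congr 2
        push_cast
        ring
      rw [← h2]
      cases j with
      | zero =>
        change -∑ k ∈ Finset.range 1, _ = 0 - _
        simp
      | succ j =>
        change -∑ k ∈ Finset.range (j + 1 + 1), _ = -∑ k ∈ Finset.range (j + 1), _ - _
        rw [Finset.sum_range_succ, neg_add, sub_eq_add_neg]
    rw [h1, ih (by omega), show -(j : ℤ) + (k + (j + 1) : ℕ) = (k : ℤ) + 1 by push_cast; ring,
      S_natCast_succ, show -(j : ℤ) - 1 + (k + (j + 1) : ℕ) = (k : ℤ) by push_cast; ring]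
    abel

theorem strictMonoOn_fst_S {n : ℕ} {x : Ω} (h : ∀ j < n, 1 ≤ (f (T^[j] x)).1) :
    StrictMonoOn (fun j : ℤ => (S T f j x).1) (Set.Icc 0 n) := by
  have key : ∀ a b : ℕ, a < b → b ≤ n → (S T f a x).1 < (S T f b x).1 := by
    intro a b hab
    induction b, hab using Nat.le_induction with
    | base =>
      intro hn
      have := h a (by omega)
      push_cast
      rw [S_natCast_succ, Prod.fst_add]
      omega
    | succ b hab ih =>
      intro hn
      have h1 := ih (by omega)
      have h2 := h b (by omega)
      push_cast
      rw [S_natCast_succ, Prod.fst_add]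
      omega
  intro a ha b hb hab
  lift a to ℕ using ha.1
  lift b to ℕ using hb.1
  exact key a b (by omega) (by exact_mod_cast hb.2)

theorem ncard_image_S {N : ℕ} {x : Ω} (h : ∀ j < 2 * N, 1 ≤ (f (T^[j] x)).1) :
    ((fun j : ℤ => S T f (j + N) x - S T f N x) '' Set.Icc (-(N : ℤ)) N).ncard = 2 * N + 1 := by
  have hinj : Set.InjOn (fun j : ℤ => S T f (j + N) x - S T f N x) (Set.Icc (-(N : ℤ)) N) := by
    intro a ha b hb hab
    have h1 := sub_left_injective hab
    have h2 := (strictMonoOn_fst_S h).injOn (x₁ := a + N) (x₂ := b + N)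
      ⟨by linarith [ha.1], by push_cast; linarith [ha.2]⟩
      ⟨by linarith [hb.1], by push_cast; linarith [hb.2]⟩ (congrArg Prod.fst h1)
    exact add_right_cancel h2
  rw [hinj.ncard_image, ← Finset.coe_Icc, Set.ncard_coe_finset, Int.card_Icc]
  omega

end Cocycle

end LCLT

theorem mainTheorem4 {Ω : Type*} [MeasurableSpace Ω] [StandardBorelSpace Ω]
    (m : MeasureTheory.Measure Ω) [MeasureTheory.IsProbabilityMeasure m]
    (T : Ω ≃ᵐ Ω) (hT : Ergodic T m) (hap : LCLT.Aperiodic m T) :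
    -- the building blocks exist
    (∃ fbar : ℕ → Fin 2 → Ω → ℤ, LCLT.IsBuildingFamily m T fbar) ∧
    -- and every function `f` constructed from such building blocks has the stated properties
    ∀ fbar : ℕ → Fin 2 → Ω → ℤ, LCLT.IsBuildingFamily m T fbar →
      -- `f` is well defined almost everywhere
      (∀ᵐ x ∂m, ∀ i : Fin 2, {k : ℕ | 1 ≤ k ∧ LCLT.level T fbar k i x ≠ 0}.Finite) ∧
      ∀ N : ℕ,
        -- `(0,0) < S_1(f) < ⋯ < S_{2N}(f)` lexicographically (recall `S_0(f) = (0,0)`)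
        0 < m {x | LCLT.S T (LCLT.lcltFun T fbar) 0 x = (0, 0) ∧ ∀ j : ℕ, j < 2 * N →
          toLex (LCLT.S T (LCLT.lcltFun T fbar) j x) <
            toLex (LCLT.S T (LCLT.lcltFun T fbar) (j + 1) x)} ∧
        -- the values `S_{j+N}(f) - S_N(f)`, `-N ≤ j ≤ N`, are distinct
        0 < m {x | ((fun j : ℤ => LCLT.S T (LCLT.lcltFun T fbar) (j + N) x -
          LCLT.S T (LCLT.lcltFun T fbar) N x) '' Set.Icc (-(N : ℤ)) N).ncard = 2 * N + 1} ∧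
        -- the values `S_j(f)`, `-N ≤ j ≤ N`, are distinct
        0 < m {x | ((fun j : ℤ => LCLT.S T (LCLT.lcltFun T fbar) j x) ''
          Set.Icc (-(N : ℤ)) N).ncard = 2 * N + 1} := by
  have hmp := hT.toMeasurePreserving
  refine ⟨LCLT.exists_isBuildingFamily hmp hap, fun fbar hb =>
    ⟨hb.ae_finite_level_ne_zero hmp, fun N => ?_⟩⟩
  obtain ⟨E, hE, hE0, hEc⟩ := hb.exists_one_le_coord hmp 0 (2 * N)
  have hEf : ∀ x ∈ E, ∀ j < 2 * N, 1 ≤ (LCLT.lcltFun T fbar (T^[j] x)).1 := hEc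
  refine ⟨hE0.trans_le (measure_mono fun x hx => ⟨rfl, fun j hj => ?_⟩),
    hE0.trans_le (measure_mono fun x hx => LCLT.ncard_image_S (hEf x hx)), ?_⟩
  · refine Prod.Lex.toLex_lt_toLex.2 (Or.inl ?_)
    exact LCLT.strictMonoOn_fst_S (hEf x hx) ⟨by omega, by omega⟩ ⟨by omega, by push_cast; omega⟩
      (by omega)
  · -- the third event is the second one, translated by `T ^ N`
    rw [← LCLT.measure_flow_preimage hmp (-(N : ℤ)) hE] at hE0
    refine hE0.trans_le (measure_mono fun x hx => ?_)
    have hx' : LCLT.flow T N (LCLT.flow T (-(N : ℤ)) x) = x := by simp [LCLT.flow_flow]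
    refine Eq.trans (congrArg Set.ncard (Set.image_congr fun j hj => ?_))
      (LCLT.ncard_image_S (hEf _ hx))
    conv_lhs => rw [← hx']
    exact LCLT.S_flow_natCast N _ hj.1
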